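/- Let $N\ge 3$, $l\ge 1$, $0<s_1<\dots<s_l<2$ and $\lambda_1,\dots,\lambda_l<0$. Put $2^*=\frac{2N}{N-2}$ and $2^*(s)=\frac{2(N-s)}{N-2}$. Let $D_0^{1,2}(\mathbb R^N)$ be the completion of $C_c^\infty(\mathbb R^N)$ for the norm $\|\nabla u\|_{L^2}$, let $$S=\inf_{u\in D_0^{1,2}(\mathbb R^N)\setminus\{0\}}\frac{\int|\nabla u|^2dx}{\left(\int|u|^{2^*}dx\right)^{2/2^*}},$$ and consider on $D_0^{1,2}(\mathbb R^N)$ the functional $$\Phi(u)=\frac12\int_{\mathbb R^N}|\nabla u|^2dx-\sum_{i=1}^l\frac{\lambda_i}{2^*(s_i)}\int_{\mathbb R^N}\frac{|u|^{2^*(s_i)}}{|x|^{s_i}}dx-\frac1{2^*}\int_{\mathbb R^N}|u|^{2^*}dx,$$ which is the energy functional of the problem $$\Delta u+\sum_{i=1}^l\lambda_i\frac{u^{2^*(s_i)-1}}{|x|^{s_i}}+u^{2^*-1}=0,\qquad u>0\ \text{ in }\mathbb R^N. \tag{P}$$ Then there are $u_0\in D_0^{1,2}(\mathbb R^N)$ with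 $\Phi(u_0)<0$. For every such $u_0$, let $\Gamma$ be the set of continuous paths $\gamma:[0,1]\to D_0^{1,2}(\mathbb R^N)$ with $\gamma(0)=0$, $\gamma(1)=u_0$, and let $c_*=\inf_{\gamma\in\Gamma}\max_{t\in[0,1]}\Phi(\gamma(t))$ be the mountain-pass level. Let $$\mathcal N=\Big\{u\in D_0^{1,2}(\mathbb R^N)\setminus\{0\}:\ \int|\nabla u|^2dx-\sum_{i=1}^l\lambda_i\int\frac{|u|^{2^*(s_i)}}{|x|^{s_i}}dx-\int|u|^{2^*}dx=0\Big\}$$ be the Nehari manifold. Then $$c_*=\inf_{u\in D_0^{1,2}(\mathbb R^N)\setminus\{0\}}\ \max_{t\ge0}\Phi(tu)=\inf_{u\in\mathcal N}\Phi(u)=\frac1N S^{N/2}.$$ This level is not attained: $\max_{t\in[0,1]}\Phi(\gamma(t))>c_*$ for every $\gamma\in\Gamma$; $\max_{t\ge0}\Phi(tu)>c_*$ for every $u\in D_0^{1,2}(\mathbb R^N)\setminus\{0\}$; $c_*$ is not a critical value of $\Phi$; and no weak solution $u\in D_0^{1,2}(\mathbb R^N)$ of (P) satisfies $\Phi(u)=c_*$.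 Consequently (P) has no least-energy solution, that is, no weak solution $u\in D_0^{1,2}(\mathbb R^N)$ of (P) which minimizes $\Phi$ on $\mathcal N$. -/

import Mathlib

open MeasureTheory Set Filter Topology
open scoped ContDiff ENNReal

noncomputable section

namespace HardySobolev

/-- Euclidean space `ℝ^N`. -/
abbrev E (N : ℕ) : Type := EuclideanSpace ℝ (Fin N)

/-- The Hardy-Sobolev critical exponent `2^*(s) = 2 (N - s) / (N - 2)`. -/
def hsExp (N : ℕ) (s : ℝ) : ℝ := 2 * ((N : ℝ) - s) / ((N : ℝ) - 2)

/-- The Sobolev critical exponent `2^* = 2 N / (N - 2)`. -/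
def critExp (N : ℕ) : ℝ := 2 * (N : ℝ) / ((N : ℝ) - 2)

/-- `2^*` as an exponent of a Lebesgue space. -/
def critLp (N : ℕ) : ℝ≥0∞ := ENNReal.ofReal (critExp N)

instance fact_one_le_critLp (N : ℕ) [hN : Fact (3 ≤ N)] : Fact (1 ≤ critLp N) := by
  refine ⟨?_⟩
  have h3 : (3 : ℝ) ≤ (N : ℝ) := by exact_mod_cast hN.out
  have hpos : (0 : ℝ) < (N : ℝ) - 2 := by linarith
  unfold critLp critExp
  rw [ENNReal.one_le_ofReal, le_div_iff₀ hpos]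
  linarith

/-- Test functions: smooth functions with compact support. -/
def IsTest {N : ℕ} (φ : E N → ℝ) : Prop :=
  ContDiff ℝ ∞ φ ∧ HasCompactSupport φ

theorem gradient_add_test {N : ℕ} {φ ψ : E N → ℝ} (hφ : IsTest φ) (hψ : IsTest ψ) (x : E N) :
    gradient (fun y => φ y + ψ y) x = gradient φ x + gradient ψ x := by
  have h1 : DifferentiableAt ℝ φ x := (hφ.1.differentiable (by simp)).differentiableAt
  have h2 : DifferentiableAt ℝ ψ x := (hψ.1.differentiable (by simp)).differentiableAt
  unfold gradient
  rw [fderiv_fun_add h1 h2, map_add]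

theorem gradient_smul_test {N : ℕ} {φ : E N → ℝ} (c : ℝ) (hφ : IsTest φ) (x : E N) :
    gradient (fun y => c * φ y) x = c • gradient φ x := by
  have h1 : DifferentiableAt ℝ φ x := (hφ.1.differentiable (by simp)).differentiableAt
  unfold gradient
  rw [fderiv_const_mul h1]
  simp

/-- The pairs `(φ, ∇φ)`, `φ` a test function, inside `L^{2^*} × L^2`. -/
def testGraph (N : ℕ) [Fact (3 ≤ N)] :
    Submodule ℝ (Lp ℝ (critLp N) (volume : Measure (E N)) ×
      Lp (E N) 2 (volume : Measure (E N))) where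
  carrier := {p | ∃ φ : E N → ℝ, IsTest φ ∧ (p.1 : E N → ℝ) =ᵐ[volume] φ ∧
    (p.2 : E N → E N) =ᵐ[volume] gradient φ}
  zero_mem' := by
    refine ⟨fun _ => 0, ⟨contDiff_const, HasCompactSupport.zero⟩, ?_, ?_⟩
    · exact Lp.coeFn_zero _ _ _
    · refine (Lp.coeFn_zero (E N) 2 (volume : Measure (E N))).trans ?_
      refine Eventually.of_forall fun x => ?_
      simp [gradient]
  add_mem' := by
    rintro p q ⟨φ, hφ, hp1, hp2⟩ ⟨ψ, hψ, hq1, hq2⟩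
    refine ⟨fun y => φ y + ψ y, ⟨hφ.1.add hψ.1, hφ.2.add hψ.2⟩, ?_, ?_⟩
    · filter_upwards [Lp.coeFn_add p.1 q.1, hp1, hq1] with x h h1 h2
      simp only [Prod.fst_add, h, Pi.add_apply, h1, h2]
    · filter_upwards [Lp.coeFn_add p.2 q.2, hp2, hq2] with x h h1 h2
      simp only [Prod.snd_add, h, Pi.add_apply, h1, h2, gradient_add_test hφ hψ]
  smul_mem' := by
    rintro c p ⟨φ, hφ, hp1, hp2⟩
    refine ⟨fun y => c * φ y, ⟨contDiff_const.mul hφ.1, hφ.2.mul_left⟩, ?_, ?_⟩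
    · filter_upwards [Lp.coeFn_smul c p.1, hp1] with x h h1
      simp only [Prod.smul_fst, h, Pi.smul_apply, h1, smul_eq_mul]
    · filter_upwards [Lp.coeFn_smul c p.2, hp2] with x h h1
      simp only [Prod.smul_snd, h, Pi.smul_apply, h1, gradient_smul_test c hφ]

/-- The space `D_0^{1,2}(ℝ^N)`, the completion of the test functions for the norm `‖∇φ‖_{L^2}`,
realised as a space of functions: its elements are the pairs `(u, ∇u)` for which some sequence of
test functions converges to `u` in `L^{2^*}` while the gradients converge to `∇u` in `L^2`. (For
`N ≥ 3` convergence of the gradients in `L^2` forces that of the functions in `L^{2^*}`, and `∇u`,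
being the weak gradient, is determined by `u`.) -/
abbrev D12 (N : ℕ) [Fact (3 ≤ N)] : Type := (testGraph N).topologicalClosure

variable {N : ℕ} [Fact (3 ≤ N)]

/-- The function underlying an element of `D_0^{1,2}(ℝ^N)`. -/
def D12.fn (u : D12 N) : Lp ℝ (critLp N) (volume : Measure (E N)) := u.1.1

/-- The weak gradient of an element of `D_0^{1,2}(ℝ^N)`; the norm of `D_0^{1,2}(ℝ^N)` is
`‖u.grad‖`. -/
def D12.grad (u : D12 N) : Lp (E N) 2 (volume : Measure (E N)) := u.1.2

/-- The Dirichlet integral `∫ |∇u|^2`. -/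
def dirichlet (u : D12 N) : ℝ := ∫ x, ‖u.grad x‖ ^ 2

/-- The integral `∫ |u|^{2^*(s)} / |x|^s`. -/
def hardyInt (s : ℝ) (u : D12 N) : ℝ := ∫ x, |u.fn x| ^ hsExp N s / ‖x‖ ^ s

/-- The integral `∫ |u|^{2^*}`. -/
def critInt (u : D12 N) : ℝ := ∫ x, |u.fn x| ^ critExp N

/-- The best constant `S` of the Sobolev embedding of `D_0^{1,2}(ℝ^N)` into `L^{2^*}(ℝ^N)`. -/
def sobolevConst (N : ℕ) [Fact (3 ≤ N)] : ℝ :=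
  sInf {q | ∃ u : D12 N, u ≠ 0 ∧ q = dirichlet u / critInt u ^ (2 / critExp N)}

/-- The energy functional. -/
def energy {l : ℕ} (s lam : Fin l → ℝ) (u : D12 N) : ℝ :=
  1 / 2 * dirichlet u - ∑ i, lam i / hsExp N (s i) * hardyInt (s i) u
    - 1 / critExp N * critInt u

/-- The continuous paths in `D_0^{1,2}(ℝ^N)` (with its gradient norm) from `0` to `u₀`. -/
def pathsTo (u₀ : D12 N) : Set (unitInterval → D12 N) :=
  {γ | Continuous (fun t => (γ t).grad) ∧ γ 0 = 0 ∧ γ 1 = u₀}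

/-- The maxima of the energy along the paths from `0` to `u₀`. -/
def pathMaxima {l : ℕ} (s lam : Fin l → ℝ) (u₀ : D12 N) : Set ℝ :=
  {m | ∃ γ ∈ pathsTo u₀, IsGreatest (range fun t => energy s lam (γ t)) m}

/-- The mountain-pass level `c_*` for the paths from `0` to `u₀`. -/
def mountainPassLevel {l : ℕ} (s lam : Fin l → ℝ) (u₀ : D12 N) : ℝ :=
  sInf (pathMaxima s lam u₀)

/-- The maxima of the energy along the rays `t ↦ t V`, `t ≥ 0`, `V ≠ 0`. -/
def rayMaxima {l : ℕ} (N : ℕ) [Fact (3 ≤ N)] (s lam : Fin l → ℝ) : Set ℝ :=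
  {m | ∃ V : D12 N, V ≠ 0 ∧ IsGreatest ((fun t : ℝ => energy s lam (t • V)) '' Ici 0) m}

/-- The Nehari manifold: the `u ≠ 0` with `⟨Φ'(u), u⟩ = 0`. -/
def nehari {l : ℕ} (N : ℕ) [Fact (3 ≤ N)] (s lam : Fin l → ℝ) : Set (D12 N) :=
  {u | u ≠ 0 ∧ dirichlet u - ∑ i, lam i * hardyInt (s i) u - critInt u = 0}

/-- Critical points of the energy: all directional derivatives exist and vanish. -/
def IsCriticalPoint {l : ℕ} (s lam : Fin l → ℝ) (u : D12 N) : Prop :=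
  ∀ v : D12 N, HasDerivAt (fun t : ℝ => energy s lam (u + t • v)) 0 0

/-- Positive weak solutions `u ∈ D_0^{1,2}(ℝ^N)` of
`Δu + ∑ i, λ_i u^{2^*(s_i) - 1} / |x|^{s_i} + u^{2^* - 1} = 0` in `ℝ^N`. -/
def IsPositiveSolution {l : ℕ} (s lam : Fin l → ℝ) (u : D12 N) : Prop :=
  (∀ᵐ x, 0 < u.fn x) ∧
  ∀ φ : E N → ℝ, IsTest φ →
    ∫ x, inner ℝ (u.grad x) (gradient φ x) =
      ∑ i, lam i * (∫ x, u.fn x ^ (hsExp N (s i) - 1) / ‖x‖ ^ s i * φ x)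
        + ∫ x, u.fn x ^ (critExp N - 1) * φ x

/-- Least-energy solutions: positive solutions of minimal energy on the Nehari manifold. -/
def IsLeastEnergySolution {l : ℕ} (s lam : Fin l → ℝ) (u : D12 N) : Prop :=
  IsPositiveSolution s lam u ∧ ∀ v ∈ nehari N s lam, energy s lam u ≤ energy s lam v

end HardySobolev

end

/-! Write `D`, `C`, `H_i` for the Dirichlet, critical and Hardy integrals, `p = 2^*` and `q_i =
2^*(s_i)`. Since every `λ_i` is negative, the Hardy terms only raise the energy above `D/2 - C/p`;
they are felt near the origin and fade under translation to infinity. This gives both the value of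
the level and its non-attainment.

Lower bound: if `u ≠ 0` and `D = C`, the Sobolev inequality gives `D/2 - C/p = D/N ≥ S^{N/2}/N`, and
at least one strictly positive Hardy term is added, so the energy is strictly above `S^{N/2}/N`
(`groundLevel_lt_energy_of_eq`). Every ray crosses `{D = C}` away from 0. So does every path to a
point of negative energy, because `C < D` near 0 and `D < C` at its end. A Nehari point maximises
the energy on its ray (`energy_smul_le_of_mem_nehari`), so it lies strictly above the level too.
Nonzero critical points and positive solutions are Nehari points, so none is at the level. No
information on Sobolev extremals is needed.

Upper bound: translate an almost optimal test function far away. `D` and `C` do not change and the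
`H_i` become small, so the maximum on its ray is close to `S^{N/2}/N` (`exists_ray_energy_lt`). That
ray meets the Nehari manifold, and it extends to a path ending at the prescribed point without
raising the maximum past the bound (`exists_path_energy_lt`).

The analytic input is the Hardy-Sobolev inequality `exists_eLpNorm_le`, for finiteness and
continuity of the integrals, and the uniqueness of the weak gradient, for their positivity. -/

noncomputable section

namespace HardySobolev

/-! ### Hardy's inequality for test functions -/

section TestFunctions

variable {N : ℕ}

theorem IsTest.differentiable {φ : E N → ℝ} (hφ : IsTest φ) : Differentiable ℝ φ :=
  hφ.1.differentiable (by simp)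

theorem IsTest.continuous_gradient {φ : E N → ℝ} (hφ : IsTest φ) : Continuous (gradient φ) :=
  (InnerProductSpace.toDual ℝ (E N)).symm.continuous.comp (hφ.1.continuous_fderiv (by simp))

theorem IsTest.hasCompactSupport_gradient {φ : E N → ℝ} (hφ : IsTest φ) :
    HasCompactSupport (gradient φ) := by
  have h := hφ.2.fderiv (𝕜 := ℝ)
  exact h.comp_left (g := (InnerProductSpace.toDual ℝ (E N)).symm) (map_zero _)

theorem IsTest.memLp {φ : E N → ℝ} (hφ : IsTest φ) (p : ℝ≥0∞) :
    MemLp φ p (volume : Measure (E N)) :=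
  hφ.1.continuous.memLp_of_hasCompactSupport hφ.2

theorem IsTest.memLp_gradient {φ : E N → ℝ} (hφ : IsTest φ) (p : ℝ≥0∞) :
    MemLp (gradient φ) p (volume : Measure (E N)) :=
  hφ.continuous_gradient.memLp_of_hasCompactSupport hφ.hasCompactSupport_gradient

theorem fderiv_apply_eq_inner_gradient (φ : E N → ℝ) (x v : E N) :
    fderiv ℝ φ x v = inner ℝ (gradient φ x) v := by
  simp [gradient]

theorem norm_gradient_eq (φ : E N → ℝ) (x : E N) : ‖gradient φ x‖ = ‖fderiv ℝ φ x‖ := by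
  simp [gradient]

/-- One component of the field `x / (|x|^2 + ε)`, a smooth substitute for `x / |x|^2`. Its
divergence is at least `(N - 2) / (|x|^2 + ε)`, which is what drives Hardy's inequality. -/
theorem hasFDerivAt_coord_mul_weight {ε : ℝ} (hε : 0 < ε) (i : Fin N) (x : E N) :
    ∃ L : E N →L[ℝ] ℝ, HasFDerivAt (fun y : E N => y i * (‖y‖ ^ 2 + ε)⁻¹) L x ∧
      L (EuclideanSpace.single i 1) =
        (‖x‖ ^ 2 + ε)⁻¹ - 2 * x i ^ 2 * ((‖x‖ ^ 2 + ε)⁻¹) ^ 2 := by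
  have hne : ‖x‖ ^ 2 + ε ≠ 0 := by positivity
  have h1 : HasFDerivAt (fun y : E N => y i) (EuclideanSpace.proj i : E N →L[ℝ] ℝ) x :=
    (EuclideanSpace.proj i : E N →L[ℝ] ℝ).hasFDerivAt
  have h2 : HasFDerivAt (fun y : E N => ‖y‖ ^ 2 + ε) (2 • innerSL ℝ x) x :=
    ((hasStrictFDerivAt_norm_sq x).hasFDerivAt).add_const ε
  have h3 := (hasDerivAt_inv hne).comp_hasFDerivAt x h2
  refine ⟨_, h1.mul h3, ?_⟩
  simp [EuclideanSpace.inner_single_right]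
  field_simp
  ring

/-- The regularised Hardy inequality for test functions. -/
theorem IsTest.regularized_hardy {φ : E N → ℝ} (hφ : IsTest φ) (hN : 3 ≤ N) {ε : ℝ}
    (hε : 0 < ε) :
    ∫ x, φ x ^ 2 * (‖x‖ ^ 2 + ε)⁻¹ ≤ (2 / ((N : ℝ) - 2)) ^ 2 * ∫ x, ‖gradient φ x‖ ^ 2 := by
  have hN2 : (0 : ℝ) < (N : ℝ) - 2 := by
    have : (3 : ℝ) ≤ N := by exact_mod_cast hN
    linarith
  have hw : Continuous fun x : E N => (‖x‖ ^ 2 + ε)⁻¹ :=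
    (by fun_prop : Continuous fun x : E N => ‖x‖ ^ 2 + ε).inv₀ fun x => by positivity
  have hφc := hφ.1.continuous
  have hgc := hφ.continuous_gradient
  have hxi : ∀ i : Fin N, Continuous fun x : E N => x i := fun i =>
    (EuclideanSpace.proj i : E N →L[ℝ] ℝ).continuous
  have hint : ∀ f : E N → ℝ, Continuous f → Integrable fun x => φ x * f x := fun f hf =>
    (hφc.mul hf).integrable_of_hasCompactSupport hφ.2.mul_right
  -- Integration by parts of `φ^2` against the `i`-th component of the field. The factor `φ x` is
  -- kept in front so that integrability follows from compact support.
  have key : ∀ i : Fin N, ∫ x, φ x * (φ x * ((‖x‖ ^ 2 + ε)⁻¹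
        - 2 * x i ^ 2 * ((‖x‖ ^ 2 + ε)⁻¹) ^ 2)
        + 2 * (gradient φ x i) * (x i * (‖x‖ ^ 2 + ε)⁻¹)) = 0 := by
    intro i
    set v : E N := EuclideanSpace.single i (1 : ℝ) with hv
    choose L hL hLv using hasFDerivAt_coord_mul_weight hε i (N := N)
    rw [← hv] at hLv
    have hd : ∀ x, HasFDerivAt (fun y => φ y ^ 2) ((2 * φ x) • fderiv ℝ φ x) x := by
      intro x
      simpa using (hφ.differentiable x).hasFDerivAt.pow 2
    have hdv : ∀ x, ((2 * φ x) • fderiv ℝ φ x) v = 2 * φ x * gradient φ x i := by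
      intro x
      rw [smul_apply, fderiv_apply_eq_inner_gradient, hv, EuclideanSpace.inner_single_right]
      simp
    have hI1 : Integrable fun x => φ x * (φ x * ((‖x‖ ^ 2 + ε)⁻¹
        - 2 * x i ^ 2 * ((‖x‖ ^ 2 + ε)⁻¹) ^ 2)) :=
      hint _ (hφc.mul (hw.sub ((continuous_const.mul ((hxi i).pow 2)).mul (hw.pow 2))))
    have hI2 : Integrable fun x => φ x * (2 * (gradient φ x i) * (x i * (‖x‖ ^ 2 + ε)⁻¹)) :=
      hint _ ((continuous_const.mul ((hxi i).comp hgc)).mul ((hxi i).mul hw))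
    have hI3 : Integrable fun x => φ x * (φ x * (x i * (‖x‖ ^ 2 + ε)⁻¹)) :=
      hint _ (hφc.mul ((hxi i).mul hw))
    have := integral_bilinear_hasFDerivAt_right_eq_neg_left_of_integrable
      (μ := (volume : Measure (E N))) (f := fun y => φ y ^ 2)
      (f' := fun x => (2 * φ x) • fderiv ℝ φ x)
      (g := fun y : E N => y i * (‖y‖ ^ 2 + ε)⁻¹) (g' := L) (v := v)
      (B := ContinuousLinearMap.mul ℝ ℝ)
      (by simp only [ContinuousLinearMap.mul_apply', hdv]
          exact hI2.congr (Eventually.of_forall fun x => by ring))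
      (by simp only [ContinuousLinearMap.mul_apply', hLv]
          exact hI1.congr (Eventually.of_forall fun x => by ring))
      (by simp only [ContinuousLinearMap.mul_apply']
          exact hI3.congr (Eventually.of_forall fun x => by ring))
      (fun x _ => hd x) (fun x _ => hL x)
    simp only [ContinuousLinearMap.mul_apply', hdv, hLv] at this
    have e : (fun x : E N => φ x * (φ x * ((‖x‖ ^ 2 + ε)⁻¹
        - 2 * x i ^ 2 * ((‖x‖ ^ 2 + ε)⁻¹) ^ 2)
        + 2 * (gradient φ x i) * (x i * (‖x‖ ^ 2 + ε)⁻¹))) = fun x =>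
        φ x ^ 2 * ((‖x‖ ^ 2 + ε)⁻¹ - 2 * x i ^ 2 * ((‖x‖ ^ 2 + ε)⁻¹) ^ 2)
        + 2 * φ x * gradient φ x i * (x i * (‖x‖ ^ 2 + ε)⁻¹) := by
      funext x; ring
    rw [e, integral_add, this]
    · ring
    · exact hI1.congr (Eventually.of_forall fun x => by ring)
    · exact hI2.congr (Eventually.of_forall fun x => by ring)
  have hsum : ∫ x, ∑ i : Fin N, φ x * (φ x * ((‖x‖ ^ 2 + ε)⁻¹
        - 2 * x i ^ 2 * ((‖x‖ ^ 2 + ε)⁻¹) ^ 2)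
        + 2 * (gradient φ x i) * (x i * (‖x‖ ^ 2 + ε)⁻¹)) = 0 := by
    rw [integral_finsetSum]
    · exact Finset.sum_eq_zero fun i _ => key i
    · intro i _
      exact hint _ ((hφc.mul (hw.sub ((continuous_const.mul ((hxi i).pow 2)).mul (hw.pow 2)))).add
        ((continuous_const.mul ((hxi i).comp hgc)).mul ((hxi i).mul hw)))
  have hIA : Integrable fun x => φ x ^ 2 * (‖x‖ ^ 2 + ε)⁻¹ :=
    (hint _ (hφc.mul hw)).congr (Eventually.of_forall fun x => by simp only [Pi.mul_apply]; ring)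
  have hIG : Integrable fun x => ‖gradient φ x‖ ^ 2 :=
    (hφ.memLp_gradient 2).integrable_norm_pow (by norm_num)
  have hle : ∫ x, (((N : ℝ) - 2) / 2 * (φ x ^ 2 * (‖x‖ ^ 2 + ε)⁻¹)
      - 2 / ((N : ℝ) - 2) * ‖gradient φ x‖ ^ 2) ≤
      ∫ x, ∑ i : Fin N, φ x * (φ x * ((‖x‖ ^ 2 + ε)⁻¹
        - 2 * x i ^ 2 * ((‖x‖ ^ 2 + ε)⁻¹) ^ 2)
        + 2 * (gradient φ x i) * (x i * (‖x‖ ^ 2 + ε)⁻¹)) := by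
    refine integral_mono ((hIA.const_mul _).sub (hIG.const_mul _))
      (integrable_finsetSum _ fun i _ => hint _ ((hφc.mul (hw.sub
        ((continuous_const.mul ((hxi i).pow 2)).mul (hw.pow 2)))).add
        ((continuous_const.mul ((hxi i).comp hgc)).mul ((hxi i).mul hw)))) fun x => ?_
    have hsq : ∑ i : Fin N, x i ^ 2 = ‖x‖ ^ 2 := (EuclideanSpace.real_norm_sq_eq x).symm
    have hin : ∑ i : Fin N, gradient φ x i * x i = inner ℝ (gradient φ x) x := by
      rw [PiLp.inner_apply]
      simp [mul_comm]
    have hS : ∑ i : Fin N, φ x * (φ x * ((‖x‖ ^ 2 + ε)⁻¹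
        - 2 * x i ^ 2 * ((‖x‖ ^ 2 + ε)⁻¹) ^ 2)
        + 2 * (gradient φ x i) * (x i * (‖x‖ ^ 2 + ε)⁻¹)) =
        φ x ^ 2 * (N * (‖x‖ ^ 2 + ε)⁻¹ - 2 * ‖x‖ ^ 2 * ((‖x‖ ^ 2 + ε)⁻¹) ^ 2)
        + 2 * φ x * (‖x‖ ^ 2 + ε)⁻¹ * inner ℝ (gradient φ x) x := by
      rw [← hsq, ← hin, hsq]
      have : ∀ i : Fin N, φ x * (φ x * ((‖x‖ ^ 2 + ε)⁻¹
        - 2 * x i ^ 2 * ((‖x‖ ^ 2 + ε)⁻¹) ^ 2)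
        + 2 * (gradient φ x i) * (x i * (‖x‖ ^ 2 + ε)⁻¹)) =
        φ x ^ 2 * (‖x‖ ^ 2 + ε)⁻¹ - (φ x ^ 2 * 2 * ((‖x‖ ^ 2 + ε)⁻¹) ^ 2) * x i ^ 2
          + (2 * φ x * (‖x‖ ^ 2 + ε)⁻¹) * (gradient φ x i * x i) := fun i => by ring
      simp only [this, Finset.sum_add_distrib, Finset.sum_sub_distrib, ← Finset.mul_sum, hsq]
      simp
      ring
    rw [hS]
    set w := (‖x‖ ^ 2 + ε)⁻¹ with hwdef
    have hwpos : 0 < w := by positivity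
    have hxw : ‖x‖ ^ 2 * w ≤ 1 := by
      rw [hwdef, ← div_eq_mul_inv, div_le_one (by positivity)]
      linarith
    have hcs : |inner ℝ (gradient φ x) x| ≤ ‖gradient φ x‖ * ‖x‖ := abs_real_inner_le_norm _ _
    have h1 : -(2 * |φ x| * w * (‖gradient φ x‖ * ‖x‖)) ≤
        2 * φ x * w * inner ℝ (gradient φ x) x := by
      have : |2 * φ x * w * inner ℝ (gradient φ x) x| ≤
          2 * |φ x| * w * (‖gradient φ x‖ * ‖x‖) := by
        rw [abs_mul, abs_mul, abs_mul, abs_of_pos hwpos, abs_two]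
        gcongr
      exact (abs_le.1 this).1
    have h2 : ‖x‖ ^ 2 * w ^ 2 ≤ w := by nlinarith
    have h3 : φ x ^ 2 * (‖x‖ ^ 2 * w ^ 2) ≤ φ x ^ 2 * w :=
      mul_le_mul_of_nonneg_left h2 (sq_nonneg _)
    -- Young's inequality, weighted so that the square absorbs half of the divergence term `(N - 2)
    -- φ^2 w` and leaves the other half.
    have h4 : 2 * |φ x| * w * (‖gradient φ x‖ * ‖x‖) ≤
        ((N : ℝ) - 2) / 2 * (φ x ^ 2 * (‖x‖ ^ 2 * w ^ 2))
          + 2 / ((N : ℝ) - 2) * ‖gradient φ x‖ ^ 2 := by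
      have : 0 ≤ ((N : ℝ) - 2) / 2 *
          (|φ x| * ‖x‖ * w - 2 / ((N : ℝ) - 2) * ‖gradient φ x‖) ^ 2 := by positivity
      have e : ((N : ℝ) - 2) / 2 *
          (|φ x| * ‖x‖ * w - 2 / ((N : ℝ) - 2) * ‖gradient φ x‖) ^ 2 =
          ((N : ℝ) - 2) / 2 * (|φ x| ^ 2 * (‖x‖ ^ 2 * w ^ 2))
          + 2 / ((N : ℝ) - 2) * ‖gradient φ x‖ ^ 2
          - 2 * |φ x| * w * (‖gradient φ x‖ * ‖x‖) := by
        field_simp; ring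
      rw [e, sq_abs] at this
      linarith
    nlinarith
  rw [hsum, integral_sub (hIA.const_mul _) (hIG.const_mul _), integral_const_mul,
    integral_const_mul, sub_nonpos] at hle
  have hpos : 0 ≤ 2 / ((N : ℝ) - 2) := by positivity
  have := mul_le_mul_of_nonneg_left hle hpos
  calc ∫ x, φ x ^ 2 * (‖x‖ ^ 2 + ε)⁻¹
      = 2 / ((N : ℝ) - 2) * (((N : ℝ) - 2) / 2 * ∫ x, φ x ^ 2 * (‖x‖ ^ 2 + ε)⁻¹) := by
        field_simp
    _ ≤ _ := this
    _ = _ := by ring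

end TestFunctions

/-! ### The critical exponents -/

section Exponents

theorem natCast_sub_two_pos (N : ℕ) [hN : Fact (3 ≤ N)] : (0 : ℝ) < (N : ℝ) - 2 := by
  have : (3 : ℝ) ≤ N := by exact_mod_cast hN.out
  linarith

/-- The Hardy-Sobolev exponent as an exponent of a Lebesgue space. -/
def hsLp (N : ℕ) (s : ℝ) : ℝ≥0∞ := ENNReal.ofReal (hsExp N s)

theorem hsExp_zero (N : ℕ) : hsExp N 0 = critExp N := by simp [hsExp, critExp]

theorem critLp_ne_top (N : ℕ) : critLp N ≠ ⊤ := ENNReal.ofReal_ne_top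

theorem hsLp_ne_top (N : ℕ) (s : ℝ) : hsLp N s ≠ ⊤ := ENNReal.ofReal_ne_top

variable (N : ℕ) [Fact (3 ≤ N)]

theorem two_lt_critExp : 2 < critExp N := by
  have := natCast_sub_two_pos N
  unfold critExp
  rw [lt_div_iff₀ this]
  linarith

theorem critExp_pos : 0 < critExp N := by linarith [two_lt_critExp N]

theorem two_lt_hsExp {s : ℝ} (hs : s < 2) : 2 < hsExp N s := by
  have := natCast_sub_two_pos N
  unfold hsExp
  rw [lt_div_iff₀ this]
  linarith

theorem hsExp_pos {s : ℝ} (hs : s < 2) : 0 < hsExp N s := by linarith [two_lt_hsExp N hs]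

theorem hsExp_lt_critExp {s : ℝ} (hs : 0 < s) : hsExp N s < critExp N := by
  have := natCast_sub_two_pos N
  unfold hsExp critExp
  gcongr
  linarith

/-- This is the exponent count in `|u|^q / |x|^s = (|u|^2 / |x|^2)^{s/2} (|u|^p)^{1 - s/2}`, which
interpolates between Hardy and Sobolev. -/
theorem hsExp_eq_interpolation (s : ℝ) : hsExp N s = s + critExp N * (1 - s / 2) := by
  have := (natCast_sub_two_pos N).ne'
  unfold hsExp critExp
  field_simp
  ring

theorem critLp_ne_zero : critLp N ≠ 0 := by
  simpa [critLp] using critExp_pos N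

theorem toReal_critLp : (critLp N).toReal = critExp N :=
  ENNReal.toReal_ofReal (critExp_pos N).le

end Exponents

/-! ### Sobolev, Hardy and Hardy-Sobolev inequalities on `D12` -/

section Space

variable {N : ℕ} [Fact (3 ≤ N)]

@[simp] theorem D12.fn_sub (u v : D12 N) : (u - v).fn = u.fn - v.fn := rfl
@[simp] theorem D12.fn_zero : (0 : D12 N).fn = 0 := rfl
@[simp] theorem D12.grad_sub (u v : D12 N) : (u - v).grad = u.grad - v.grad := rfl
@[simp] theorem D12.grad_smul (t : ℝ) (u : D12 N) : (t • u).grad = t • u.grad := rfl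
@[simp] theorem D12.grad_zero : (0 : D12 N).grad = 0 := rfl

theorem D12.continuous_fn : Continuous (D12.fn : D12 N → _) :=
  continuous_fst.comp continuous_subtype_val

theorem D12.continuous_grad : Continuous (D12.grad : D12 N → _) :=
  continuous_snd.comp continuous_subtype_val

/-- A test function as an element of `D_0^{1,2}(ℝ^N)`. -/
def ofTest (φ : E N → ℝ) (hφ : IsTest φ) : D12 N :=
  ⟨((hφ.memLp _).toLp φ, (hφ.memLp_gradient 2).toLp (gradient φ)),
    Submodule.le_topologicalClosure _
      ⟨φ, hφ, (hφ.memLp _).coeFn_toLp, (hφ.memLp_gradient 2).coeFn_toLp⟩⟩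

theorem fn_ofTest {φ : E N → ℝ} (hφ : IsTest φ) : (ofTest φ hφ).fn =ᵐ[volume] φ :=
  (hφ.memLp _).coeFn_toLp

theorem grad_ofTest {φ : E N → ℝ} (hφ : IsTest φ) :
    (ofTest φ hφ).grad =ᵐ[volume] gradient φ :=
  (hφ.memLp_gradient 2).coeFn_toLp

theorem exists_seq_ofTest_tendsto (u : D12 N) :
    ∃ (φ : ℕ → E N → ℝ) (hφ : ∀ n, IsTest (φ n)),
      Tendsto (fun n => ofTest (φ n) (hφ n)) atTop (𝓝 u) := by
  obtain ⟨p, hp, hlim⟩ := mem_closure_iff_seq_limit.1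
    (show u.1 ∈ closure (testGraph N : Set (Lp ℝ (critLp N) (volume : Measure (E N)) ×
      Lp (E N) 2 (volume : Measure (E N)))) from u.2)
  choose φ hφ h1 h2 using hp
  refine ⟨φ, hφ, tendsto_subtype_rng.2 ?_⟩
  convert hlim using 2 with n
  refine Prod.ext (Lp.ext ?_) (Lp.ext ?_)
  · exact (fn_ofTest (hφ n)).trans (h1 n).symm
  · exact (grad_ofTest (hφ n)).trans (h2 n).symm

/-- A closed property that holds for test functions holds on `D_0^{1,2}(ℝ^N)`. -/
theorem D12.induction {P : D12 N → Prop} (hP : IsClosed {u | P u})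
    (h : ∀ (φ : E N → ℝ) (hφ : IsTest φ), P (ofTest φ hφ)) (u : D12 N) : P u := by
  obtain ⟨φ, hφ, hlim⟩ := exists_seq_ofTest_tendsto u
  exact hP.mem_of_tendsto hlim (Eventually.of_forall fun n => h _ _)

/-- The Sobolev inequality. -/
theorem exists_norm_fn_le (N : ℕ) [Fact (3 ≤ N)] :
    ∃ K : ℝ, 0 ≤ K ∧ ∀ u : D12 N, ‖u.fn‖ ≤ K * ‖u.grad‖ := by
  refine ⟨(SNormLESNormFDerivOfEqConst ℝ (volume : Measure (E N)) (2 : NNReal) : ℝ),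
    NNReal.coe_nonneg _, fun u => ?_⟩
  refine D12.induction (isClosed_le D12.continuous_fn.norm
    (continuous_const.mul D12.continuous_grad.norm)) (fun φ hφ => ?_) u
  have hN := natCast_sub_two_pos N
  have hp : ((critExp N).toNNReal : ℝ)⁻¹ = ((2 : NNReal) : ℝ)⁻¹
      - (Module.finrank ℝ (E N) : ℝ)⁻¹ := by
    rw [Real.coe_toNNReal _ (critExp_pos N).le, finrank_euclideanSpace_fin]
    have h0 : (N : ℝ) ≠ 0 := by linarith
    have h2 := hN.ne'
    unfold critExp
    push_cast
    field_simp
  have h := eLpNorm_le_eLpNorm_fderiv_of_eq (F := ℝ) (volume : Measure (E N))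
    (hφ.1.of_le (by simp)) hφ.2
    (p := 2) (p' := (critExp N).toNNReal) (by norm_num)
    (by rw [finrank_euclideanSpace_fin]; have : (0 : ℝ) < N := by linarith
        exact_mod_cast this) hp
  have hf : ‖(ofTest φ hφ).fn‖ = (eLpNorm φ (critLp N) volume).toReal := by
    rw [Lp.norm_def, eLpNorm_congr_ae (fn_ofTest hφ)]
  have hg : ‖(ofTest φ hφ).grad‖ = (eLpNorm (gradient φ) 2 volume).toReal := by
    rw [Lp.norm_def, eLpNorm_congr_ae (grad_ofTest hφ)]
  rw [Pi.mul_apply, hf, hg, ← ENNReal.coe_toReal, ← ENNReal.toReal_mul]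
  refine ENNReal.toReal_mono
    (ENNReal.mul_ne_top ENNReal.coe_ne_top (hφ.memLp_gradient 2).eLpNorm_ne_top) ?_
  have : eLpNorm (gradient φ) 2 volume = eLpNorm (fderiv ℝ φ) 2 volume :=
    eLpNorm_congr_norm_ae (Eventually.of_forall (norm_gradient_eq φ))
  rw [this]
  exact h

theorem dirichlet_eq (u : D12 N) : dirichlet u = ‖u.grad‖ ^ 2 := by
  rw [← real_inner_self_eq_norm_sq, L2.inner_def]
  simp [dirichlet]

theorem nontrivial_E (N : ℕ) [hN : Fact (3 ≤ N)] : Nontrivial (E N) := by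
  have : Nonempty (Fin N) := ⟨⟨0, by have := hN.out; omega⟩⟩
  infer_instance

theorem ae_ne_zero (N : ℕ) [Fact (3 ≤ N)] : ∀ᵐ x : E N, x ≠ 0 := by
  have := nontrivial_E N
  exact Measure.ae_ne volume 0

/-- Hardy's inequality. -/
theorem lintegral_hardy_le (u : D12 N) :
    ∫⁻ x, ENNReal.ofReal (‖x‖ ^ (-2 : ℝ)) * ‖u.fn x‖ₑ ^ (2 : ℝ) ≤
      ENNReal.ofReal ((2 / ((N : ℝ) - 2)) ^ 2 * ‖u.grad‖ ^ 2) := by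
  obtain ⟨φ, hφ, hlim⟩ := exists_seq_ofTest_tendsto u
  have hfn : Tendsto (fun n => (ofTest (φ n) (hφ n)).fn) atTop (𝓝 u.fn) :=
    (D12.continuous_fn.tendsto u).comp hlim
  obtain ⟨ns, hns, hae⟩ := (tendstoInMeasure_of_tendsto_Lp hfn).exists_seq_tendsto_ae
  -- The regularisation `1 / (n + 1)` shrinks along the a.e. convergent subsequence, so one
  -- application of Fatou's lemma removes both the regularisation and the approximation.
  set f : ℕ → E N → ℝ≥0∞ := fun n x =>
    ENNReal.ofReal (φ (ns n) x ^ 2 * (‖x‖ ^ 2 + 1 / ((n : ℝ) + 1))⁻¹) with hf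
  have hpos : ∀ n : ℕ, (0 : ℝ) < 1 / ((n : ℝ) + 1) := fun n => by positivity
  have hcont : ∀ n, Continuous fun x : E N =>
      φ (ns n) x ^ 2 * (‖x‖ ^ 2 + 1 / ((n : ℝ) + 1))⁻¹ := fun n =>
    ((hφ (ns n)).1.continuous.pow 2).mul
      ((by fun_prop : Continuous fun x : E N => ‖x‖ ^ 2 + 1 / ((n : ℝ) + 1)).inv₀
        fun x => by have := hpos n; positivity)
  have hle : ∀ n, ∫⁻ x, f n x ≤
      ENNReal.ofReal ((2 / ((N : ℝ) - 2)) ^ 2 * ‖(ofTest (φ (ns n)) (hφ (ns n))).grad‖ ^ 2) := by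
    intro n
    rw [hf, ← ofReal_integral_eq_lintegral_ofReal]
    · refine ENNReal.ofReal_le_ofReal (((hφ (ns n)).regularized_hardy Fact.out (hpos n)).trans ?_)
      rw [← dirichlet_eq, dirichlet]
      refine le_of_eq (congrArg _ (integral_congr_ae ?_))
      filter_upwards [grad_ofTest (hφ (ns n))] with x hx
      rw [hx]
    · refine (hcont n).integrable_of_hasCompactSupport ?_
      have : (fun x : E N => φ (ns n) x ^ 2 * (‖x‖ ^ 2 + 1 / ((n : ℝ) + 1))⁻¹) =
          fun x => φ (ns n) x * (φ (ns n) x * (‖x‖ ^ 2 + 1 / ((n : ℝ) + 1))⁻¹) := by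
        funext x; ring
      rw [this]
      exact (hφ (ns n)).2.mul_right
    · exact Eventually.of_forall fun x => by have := hpos n; positivity
  have hlimf : ∀ᵐ x : E N, Tendsto (fun n => f n x) atTop
      (𝓝 (ENNReal.ofReal (‖x‖ ^ (-2 : ℝ)) * ‖u.fn x‖ₑ ^ (2 : ℝ))) := by
    have hall : ∀ᵐ x : E N, ∀ n, (ofTest (φ n) (hφ n)).fn x = φ n x :=
      ae_all_iff.2 fun n => fn_ofTest (hφ n)
    filter_upwards [ae_ne_zero N, hall, hae] with x hx hx1 hx2
    simp only [hx1] at hx2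
    have e : ENNReal.ofReal (‖x‖ ^ (-2 : ℝ)) * ‖u.fn x‖ₑ ^ (2 : ℝ) =
        ENNReal.ofReal (u.fn x ^ 2 * (‖x‖ ^ 2 + 0)⁻¹) := by
      rw [Real.rpow_neg (norm_nonneg _), Real.rpow_two, add_zero, mul_comm,
        ENNReal.ofReal_mul (sq_nonneg _), Real.enorm_eq_ofReal_abs,
        ENNReal.ofReal_rpow_of_nonneg (abs_nonneg _) (by norm_num), Real.rpow_two, sq_abs]
    rw [e]
    refine ENNReal.tendsto_ofReal ((hx2.pow 2).mul (Tendsto.inv₀ ?_ ?_))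
    · exact tendsto_const_nhds.add tendsto_one_div_add_atTop_nhds_zero_nat
    · have := norm_pos_iff.2 hx
      positivity
  calc ∫⁻ x, ENNReal.ofReal (‖x‖ ^ (-2 : ℝ)) * ‖u.fn x‖ₑ ^ (2 : ℝ)
      = ∫⁻ x, liminf (fun n => f n x) atTop :=
        lintegral_congr_ae (hlimf.mono fun x hx => hx.liminf_eq.symm)
    _ ≤ liminf (fun n => ∫⁻ x, f n x) atTop :=
        lintegral_liminf_le' fun n => ((hcont n).measurable.ennreal_ofReal).aemeasurable
    _ ≤ liminf (fun n => ENNReal.ofReal ((2 / ((N : ℝ) - 2)) ^ 2 *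
          ‖(ofTest (φ (ns n)) (hφ (ns n))).grad‖ ^ 2)) atTop :=
        liminf_le_liminf (Eventually.of_forall hle)
    _ = ENNReal.ofReal ((2 / ((N : ℝ) - 2)) ^ 2 * ‖u.grad‖ ^ 2) := by
        refine Tendsto.liminf_eq (ENNReal.tendsto_ofReal (Tendsto.const_mul _ (Tendsto.pow ?_ 2)))
        exact (((D12.continuous_grad.norm.tendsto u).comp hlim).comp hns.tendsto_atTop)

/-- The measure `dx / |x|^s` on `ℝ^N`. -/
def hardyMeasure (N : ℕ) (s : ℝ) : Measure (E N) :=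
  volume.withDensity fun x => ENNReal.ofReal (‖x‖ ^ (-s))

theorem measurable_hardy_density (N : ℕ) (s : ℝ) :
    Measurable fun x : E N => ENNReal.ofReal (‖x‖ ^ (-s)) := by
  fun_prop

theorem hardyMeasure_absolutelyContinuous (N : ℕ) (s : ℝ) :
    hardyMeasure N s ≪ (volume : Measure (E N)) :=
  withDensity_absolutelyContinuous _ _

theorem toReal_hsLp {s : ℝ} (hs : s < 2) : (hsLp N s).toReal = hsExp N s :=
  ENNReal.toReal_ofReal (hsExp_pos N hs).le

theorem hsLp_ne_zero {s : ℝ} (hs : s < 2) : hsLp N s ≠ 0 := by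
  simpa [hsLp] using hsExp_pos N hs

theorem one_le_hsLp {s : ℝ} (hs : s < 2) : 1 ≤ hsLp N s := by
  rw [hsLp, ENNReal.one_le_ofReal]
  linarith [two_lt_hsExp N hs]

theorem aestronglyMeasurable_fn (u : D12 N) (s : ℝ) :
    AEStronglyMeasurable u.fn (hardyMeasure N s) :=
  (Lp.aestronglyMeasurable u.fn).mono_ac (hardyMeasure_absolutelyContinuous N s)

/-- The Hardy-Sobolev inequality. -/
theorem exists_eLpNorm_le {s : ℝ} (hs0 : 0 ≤ s) (hs2 : s < 2) :
    ∃ K : ℝ, 0 ≤ K ∧ ∀ u : D12 N,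
      eLpNorm u.fn (hsLp N s) (hardyMeasure N s) ≤ ENNReal.ofReal (K * ‖u.grad‖) := by
  obtain ⟨K, hK, hsob⟩ := exists_norm_fn_le N
  have hp := critExp_pos N
  have hq := hsExp_pos N hs2
  set A : ℝ := (2 / ((N : ℝ) - 2)) ^ 2 with hA
  have hA0 : 0 ≤ A := by positivity
  refine ⟨(A ^ (s / 2) * (K ^ critExp N) ^ (1 - s / 2)) ^ (1 / hsExp N s), by positivity,
    fun u => ?_⟩
  have hs1 : 0 ≤ 1 - s / 2 := by linarith
  have hG := norm_nonneg u.grad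
  have hB : ∫⁻ x, ‖u.fn x‖ₑ ^ critExp N ≤ ENNReal.ofReal ((K * ‖u.grad‖) ^ critExp N) := by
    have h := eLpNorm_eq_lintegral_rpow_enorm_toReal (μ := (volume : Measure (E N)))
      (critLp_ne_zero N) (critLp_ne_top N) (f := u.fn)
    rw [toReal_critLp, ← Lp.enorm_def] at h
    have h2 : ∫⁻ x, ‖u.fn x‖ₑ ^ critExp N = ‖u.fn‖ₑ ^ critExp N := by
      rw [h, ← ENNReal.rpow_mul, one_div_mul_cancel hp.ne', ENNReal.rpow_one]
    rw [h2, ← ENNReal.ofReal_rpow_of_nonneg (by positivity) hp.le, ← ofReal_norm]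
    exact ENNReal.rpow_le_rpow (ENNReal.ofReal_le_ofReal (hsob u)) hp.le
  have hmeas : AEMeasurable (fun x => ‖u.fn x‖ₑ) (volume : Measure (E N)) :=
    (Lp.aestronglyMeasurable u.fn).enorm
  have hpt : ∀ x : E N, ENNReal.ofReal (‖x‖ ^ (-s)) * ‖u.fn x‖ₑ ^ hsExp N s =
      (ENNReal.ofReal (‖x‖ ^ (-2 : ℝ)) * ‖u.fn x‖ₑ ^ (2 : ℝ)) ^ (s / 2)
        * (‖u.fn x‖ₑ ^ critExp N) ^ (1 - s / 2) := by
    intro x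
    rw [ENNReal.mul_rpow_of_nonneg _ _ (by linarith), ← ENNReal.rpow_mul, ← ENNReal.rpow_mul,
      mul_assoc, ← ENNReal.rpow_add_of_nonneg _ _ (by linarith) (by positivity),
      ENNReal.ofReal_rpow_of_nonneg (by positivity) (by linarith),
      ← Real.rpow_mul (norm_nonneg _), hsExp_eq_interpolation]
    congr 3
    · ring
    · ring
  rw [eLpNorm_eq_lintegral_rpow_enorm_toReal (hsLp_ne_zero hs2) (hsLp_ne_top N s),
    toReal_hsLp hs2, hardyMeasure, lintegral_withDensity_eq_lintegral_mul₀
      (measurable_hardy_density N s).aemeasurable (hmeas.pow_const _)]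
  simp only [Pi.mul_apply, hpt]
  have hH := ENNReal.lintegral_mul_norm_pow_le (μ := (volume : Measure (E N)))
    (f := fun x => ENNReal.ofReal (‖x‖ ^ (-2 : ℝ)) * ‖u.fn x‖ₑ ^ (2 : ℝ))
    (g := fun x => ‖u.fn x‖ₑ ^ critExp N)
    ((measurable_hardy_density N 2).aemeasurable.mul (hmeas.pow_const _)) (hmeas.pow_const _)
    (p := s / 2) (q := 1 - s / 2) (by linarith) hs1 (by ring)
  refine (ENNReal.rpow_le_rpow (hH.trans (mul_le_mul' (ENNReal.rpow_le_rpow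
    (lintegral_hardy_le u) (by linarith)) (ENNReal.rpow_le_rpow hB hs1))) (by positivity)).trans ?_
  rw [ENNReal.ofReal_rpow_of_nonneg (by positivity) (by linarith),
    ENNReal.ofReal_rpow_of_nonneg (by positivity) hs1, ← ENNReal.ofReal_mul (by positivity),
    ENNReal.ofReal_rpow_of_nonneg (by positivity) (by positivity)]
  refine ENNReal.ofReal_le_ofReal (le_of_eq ?_)
  rw [Real.mul_rpow hA0 (by positivity), Real.mul_rpow hK hG,
    Real.mul_rpow (x := K ^ critExp N) (by positivity) (by positivity)]
  have e : (‖u.grad‖ ^ 2) ^ (s / 2) * (‖u.grad‖ ^ critExp N) ^ (1 - s / 2) =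
      ‖u.grad‖ ^ hsExp N s := by
    rw [← Real.rpow_two, ← Real.rpow_mul hG, ← Real.rpow_mul hG,
      ← Real.rpow_add_of_nonneg hG (by linarith) (by positivity), hsExp_eq_interpolation]
    congr 1
    ring
  rw [show ∀ a b c d : ℝ, a * b * (c * d) = a * c * (b * d) by intros; ring, e,
    Real.mul_rpow (by positivity) (by positivity), ← Real.rpow_mul hG,
    mul_one_div_cancel hq.ne', Real.rpow_one]

end Space

/-! ### Continuity, homogeneity and positivity of the integrals -/

section Functionals

variable {N : ℕ}

theorem integral_hardyMeasure (s : ℝ) (f : E N → ℝ) :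
    ∫ x, f x ∂(hardyMeasure N s) = ∫ x, f x / ‖x‖ ^ s := by
  rw [hardyMeasure, integral_withDensity_eq_integral_toReal_smul (measurable_hardy_density N s)
    (Eventually.of_forall fun x => ENNReal.ofReal_lt_top)]
  refine integral_congr_ae (Eventually.of_forall fun x => ?_)
  simp only
  rw [ENNReal.toReal_ofReal (by positivity), Real.rpow_neg (norm_nonneg _), smul_eq_mul,
    div_eq_inv_mul]

theorem hardyMeasure_zero (N : ℕ) : hardyMeasure N 0 = volume := by
  simp [hardyMeasure]

variable [Fact (3 ≤ N)]

/-- The density is positive off the origin, a null set. Hence vanishing in the weighted norm means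
vanishing almost everywhere. -/
theorem absolutelyContinuous_hardyMeasure (N : ℕ) [Fact (3 ≤ N)] (s : ℝ) :
    (volume : Measure (E N)) ≪ hardyMeasure N s := by
  refine withDensity_absolutelyContinuous' (measurable_hardy_density N s).aemeasurable ?_
  filter_upwards [ae_ne_zero N] with x hx
  have := norm_pos_iff.2 hx
  simp only [ne_eq, ENNReal.ofReal_eq_zero, not_le]
  positivity

/-- The norm of `u` in `L^{2^*(s)}(dx / |x|^s)`. -/
def hsNorm (s : ℝ) (u : D12 N) : ℝ := (eLpNorm u.fn (hsLp N s) (hardyMeasure N s)).toReal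

theorem hsNorm_nonneg (s : ℝ) (u : D12 N) : 0 ≤ hsNorm s u := ENNReal.toReal_nonneg

theorem memLp_fn {s : ℝ} (hs0 : 0 ≤ s) (hs2 : s < 2) (u : D12 N) :
    MemLp u.fn (hsLp N s) (hardyMeasure N s) := by
  obtain ⟨K, -, h⟩ := exists_eLpNorm_le (N := N) hs0 hs2
  exact ⟨aestronglyMeasurable_fn u s, (h u).trans_lt ENNReal.ofReal_lt_top⟩

theorem exists_hsNorm_le {s : ℝ} (hs0 : 0 ≤ s) (hs2 : s < 2) :
    ∃ K : ℝ, 0 ≤ K ∧ ∀ u : D12 N, hsNorm s u ≤ K * ‖u.grad‖ := by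
  obtain ⟨K, hK, h⟩ := exists_eLpNorm_le (N := N) hs0 hs2
  exact ⟨K, hK, fun u => ENNReal.toReal_le_of_le_ofReal (by positivity) (h u)⟩

theorem hsNorm_le_add {s : ℝ} (hs0 : 0 ≤ s) (hs2 : s < 2) (u v : D12 N) :
    hsNorm s u ≤ hsNorm s v + hsNorm s (u - v) := by
  unfold hsNorm
  rw [← ENNReal.toReal_add (memLp_fn hs0 hs2 v).eLpNorm_ne_top
    (memLp_fn hs0 hs2 (u - v)).eLpNorm_ne_top]
  refine ENNReal.toReal_mono (ENNReal.add_ne_top.2 ⟨(memLp_fn hs0 hs2 v).eLpNorm_ne_top,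
    (memLp_fn hs0 hs2 (u - v)).eLpNorm_ne_top⟩) ?_
  have : u.fn =ᵐ[hardyMeasure N s] v.fn + (u - v).fn := by
    refine (hardyMeasure_absolutelyContinuous N s).ae_le ?_
    rw [D12.fn_sub]
    filter_upwards [Lp.coeFn_sub u.fn v.fn] with x hx
    rw [Pi.add_apply, hx, Pi.sub_apply]
    ring
  rw [eLpNorm_congr_ae this]
  exact eLpNorm_add_le (aestronglyMeasurable_fn v s) (aestronglyMeasurable_fn _ s)
    (one_le_hsLp hs2)

theorem hsNorm_smul {s : ℝ} (t : ℝ) (u : D12 N) : hsNorm s (t • u) = |t| * hsNorm s u := by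
  unfold hsNorm
  have : (t • u).fn =ᵐ[hardyMeasure N s] t • (u.fn : E N → ℝ) :=
    (hardyMeasure_absolutelyContinuous N s).ae_le (Lp.coeFn_smul t u.fn)
  rw [eLpNorm_congr_ae this, eLpNorm_const_smul, ENNReal.toReal_mul]
  simp

theorem tendsto_mul_norm_grad_sub (K : ℝ) (v : D12 N) :
    Tendsto (fun u : D12 N => K * ‖u.grad - v.grad‖) (𝓝 v) (𝓝 0) := by
  have h := tendsto_iff_norm_sub_tendsto_zero.1 (D12.continuous_grad.tendsto v)
  simpa using h.const_mul K

/-- Minkowski's inequality and the Hardy-Sobolev inequality make the weighted norm Lipschitz in the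
gradient norm. -/
theorem continuous_hsNorm {s : ℝ} (hs0 : 0 ≤ s) (hs2 : s < 2) :
    Continuous (hsNorm s : D12 N → ℝ) := by
  obtain ⟨K, hK, h⟩ := exists_hsNorm_le (N := N) hs0 hs2
  have hlip : ∀ u v : D12 N, |hsNorm s u - hsNorm s v| ≤ K * ‖u.grad - v.grad‖ := by
    intro u v
    have h1 := (hsNorm_le_add hs0 hs2 u v).trans (add_le_add_right (h (u - v)) _)
    have h2 := (hsNorm_le_add hs0 hs2 v u).trans (add_le_add_right (h (v - u)) _)
    rw [D12.grad_sub] at h1 h2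
    rw [norm_sub_rev] at h2
    exact abs_sub_le_iff.2 ⟨by linarith, by linarith⟩
  refine continuous_iff_continuousAt.2 fun v => tendsto_iff_norm_sub_tendsto_zero.2 ?_
  refine squeeze_zero (fun u => norm_nonneg _) (fun u => hlip u v) ?_
  exact tendsto_mul_norm_grad_sub K v

theorem hardyInt_eq {s : ℝ} (hs0 : 0 ≤ s) (hs2 : s < 2) (u : D12 N) :
    hardyInt s u = hsNorm s u ^ hsExp N s := by
  have hq := hsExp_pos N hs2
  have hI : 0 ≤ ∫ x, ‖u.fn x‖ ^ hsExp N s ∂(hardyMeasure N s) :=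
    integral_nonneg fun x => by positivity
  rw [hsNorm, (memLp_fn hs0 hs2 u).eLpNorm_eq_integral_rpow_norm (hsLp_ne_zero hs2)
    (hsLp_ne_top N s), toReal_hsLp hs2, ENNReal.toReal_ofReal (by positivity),
    ← Real.rpow_mul hI, inv_mul_cancel₀ hq.ne', Real.rpow_one, integral_hardyMeasure]
  rfl

theorem hardyInt_zero (u : D12 N) : hardyInt 0 u = critInt u := by
  simp [hardyInt, critInt, hsExp_zero]

theorem hardyInt_nonneg (s : ℝ) (u : D12 N) : 0 ≤ hardyInt s u :=
  integral_nonneg fun x => by positivity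

theorem critInt_nonneg (u : D12 N) : 0 ≤ critInt u := by
  rw [← hardyInt_zero]
  exact hardyInt_nonneg 0 u

theorem dirichlet_nonneg (u : D12 N) : 0 ≤ dirichlet u := by
  rw [dirichlet_eq]
  positivity

theorem continuous_hardyInt {s : ℝ} (hs0 : 0 ≤ s) (hs2 : s < 2) :
    Continuous (hardyInt s : D12 N → ℝ) := by
  simp only [funext (hardyInt_eq (N := N) hs0 hs2)]
  exact (continuous_hsNorm hs0 hs2).rpow_const fun u => Or.inr (hsExp_pos N hs2).le

theorem continuous_critInt : Continuous (critInt : D12 N → ℝ) := by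
  simp only [← funext (hardyInt_zero (N := N))]
  exact continuous_hardyInt le_rfl two_pos

theorem continuous_dirichlet : Continuous (dirichlet : D12 N → ℝ) := by
  simp only [funext (dirichlet_eq (N := N))]
  exact D12.continuous_grad.norm.pow 2

theorem hardyInt_smul {s : ℝ} (hs0 : 0 ≤ s) (hs2 : s < 2) (t : ℝ) (u : D12 N) :
    hardyInt s (t • u) = |t| ^ hsExp N s * hardyInt s u := by
  rw [hardyInt_eq hs0 hs2, hardyInt_eq hs0 hs2, hsNorm_smul,
    Real.mul_rpow (abs_nonneg t) (hsNorm_nonneg s u)]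

theorem critInt_smul (t : ℝ) (u : D12 N) :
    critInt (t • u) = |t| ^ critExp N * critInt u := by
  rw [← hardyInt_zero, hardyInt_smul le_rfl two_pos, hardyInt_zero, hsExp_zero]

theorem dirichlet_smul (t : ℝ) (u : D12 N) : dirichlet (t • u) = t ^ 2 * dirichlet u := by
  rw [dirichlet_eq, dirichlet_eq, D12.grad_smul, norm_smul, mul_pow, Real.norm_eq_abs, sq_abs]

/-- The conjugate exponent of `2^*(s)`. -/
def hsConjLp (N : ℕ) (s : ℝ) : ℝ≥0∞ := ENNReal.ofReal (hsExp N s / (hsExp N s - 1))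

theorem holderConjugate_hsExp {s : ℝ} (hs2 : s < 2) :
    (hsExp N s).HolderConjugate (hsExp N s / (hsExp N s - 1)) :=
  Real.HolderConjugate.conjExponent (by linarith [two_lt_hsExp N hs2])

theorem integrable_fn_mul {s : ℝ} (hs0 : 0 ≤ s) (hs2 : s < 2) {g : E N → ℝ}
    (hg : MemLp g (hsConjLp N s) (hardyMeasure N s)) (v : D12 N) :
    Integrable (fun x => v.fn x * g x) (hardyMeasure N s) := by
  have : ENNReal.HolderConjugate (hsLp N s) (hsConjLp N s) :=
    (holderConjugate_hsExp hs2).ennrealOfReal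
  exact (memLp_fn hs0 hs2 v).integrable_mul hg

theorem abs_integral_fn_mul_le {s : ℝ} (hs0 : 0 ≤ s) (hs2 : s < 2) {g : E N → ℝ}
    (hg : MemLp g (hsConjLp N s) (hardyMeasure N s)) :
    ∃ K : ℝ, 0 ≤ K ∧ ∀ v : D12 N, |∫ x, v.fn x * g x ∂(hardyMeasure N s)| ≤ K * ‖v.grad‖ := by
  obtain ⟨K, hK, h⟩ := exists_hsNorm_le (N := N) hs0 hs2
  set G := (∫ x, ‖g x‖ ^ (hsExp N s / (hsExp N s - 1)) ∂(hardyMeasure N s)) ^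
    (1 / (hsExp N s / (hsExp N s - 1))) with hG
  have hG0 : 0 ≤ G := Real.rpow_nonneg (integral_nonneg fun x => by positivity) _
  refine ⟨K * G, by positivity, fun v => ?_⟩
  have h1 := integral_mul_norm_le_Lp_mul_Lq (holderConjugate_hsExp (N := N) hs2)
    (memLp_fn hs0 hs2 v) hg
  have h2 : (∫ x, ‖v.fn x‖ ^ hsExp N s ∂(hardyMeasure N s)) ^ (1 / hsExp N s) = hsNorm s v := by
    rw [integral_hardyMeasure]
    have : ∫ x, ‖v.fn x‖ ^ hsExp N s / ‖x‖ ^ s = hardyInt s v := rfl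
    rw [this, hardyInt_eq hs0 hs2, ← Real.rpow_mul (hsNorm_nonneg s v),
      mul_one_div_cancel (hsExp_pos N hs2).ne', Real.rpow_one]
  rw [h2] at h1
  calc |∫ x, v.fn x * g x ∂(hardyMeasure N s)|
      ≤ ∫ x, ‖v.fn x * g x‖ ∂(hardyMeasure N s) := by
        rw [← Real.norm_eq_abs]
        exact norm_integral_le_integral_norm _
    _ = ∫ x, ‖v.fn x‖ * ‖g x‖ ∂(hardyMeasure N s) := by simp only [norm_mul]
    _ ≤ hsNorm s v * G := h1
    _ ≤ K * ‖v.grad‖ * G := mul_le_mul_of_nonneg_right (h v) hG0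
    _ = K * G * ‖v.grad‖ := by ring

/-- Functions in the dual Lebesgue space define continuous functionals on `D_0^{1,2}(ℝ^N)`. -/
theorem continuous_integral_fn_mul {s : ℝ} (hs0 : 0 ≤ s) (hs2 : s < 2) {g : E N → ℝ}
    (hg : MemLp g (hsConjLp N s) (hardyMeasure N s)) :
    Continuous fun v : D12 N => ∫ x, v.fn x * g x ∂(hardyMeasure N s) := by
  obtain ⟨K, hK, h⟩ := abs_integral_fn_mul_le hs0 hs2 hg
  have hsub : ∀ u v : D12 N, ∫ x, u.fn x * g x ∂(hardyMeasure N s)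
      - ∫ x, v.fn x * g x ∂(hardyMeasure N s) =
      ∫ x, (u - v).fn x * g x ∂(hardyMeasure N s) := by
    intro u v
    rw [← integral_sub (integrable_fn_mul hs0 hs2 hg u) (integrable_fn_mul hs0 hs2 hg v)]
    refine integral_congr_ae ((hardyMeasure_absolutelyContinuous N s).ae_le ?_)
    filter_upwards [Lp.coeFn_sub u.fn v.fn] with x hx
    rw [D12.fn_sub, hx, Pi.sub_apply]
    ring
  refine continuous_iff_continuousAt.2 fun v => tendsto_iff_norm_sub_tendsto_zero.2 ?_
  refine squeeze_zero (fun u => norm_nonneg _) (g := fun u => K * ‖u.grad - v.grad‖)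
    (fun u => ?_) ?_
  · rw [hsub, Real.norm_eq_abs]
    exact h (u - v)
  · exact tendsto_mul_norm_grad_sub K v

/-- The second component of an element of `D_0^{1,2}(ℝ^N)` is the weak gradient of the first. -/
theorem integral_grad_mul (u : D12 N) {ψ : E N → ℝ} (hψ : IsTest ψ) (e : E N) :
    ∫ x, inner ℝ (ψ x • e) (u.grad x) = -∫ x, u.fn x * inner ℝ (gradient ψ x) e := by
  have hψe : MemLp (fun x => ψ x • e) 2 (volume : Measure (E N)) :=
    (hψ.1.continuous.smul continuous_const).memLp_of_hasCompactSupport hψ.2.smul_right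
  have hL : ∀ v : D12 N, ∫ x, inner ℝ (ψ x • e) (v.grad x) = inner ℝ (hψe.toLp _) v.grad := by
    intro v
    rw [L2.inner_def]
    refine integral_congr_ae ?_
    filter_upwards [hψe.coeFn_toLp] with x hx
    rw [hx]
  have hg : MemLp (fun x => inner ℝ (gradient ψ x) e) (hsConjLp N 0) (hardyMeasure N 0) := by
    rw [hardyMeasure_zero]
    refine (hψ.continuous_gradient.inner continuous_const).memLp_of_hasCompactSupport ?_
    exact hψ.hasCompactSupport_gradient.comp_left (g := fun y => inner ℝ y e) (by simp)
  have hR := continuous_integral_fn_mul le_rfl two_pos hg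
  rw [hardyMeasure_zero] at hR
  refine D12.induction (P := fun v => ∫ x, inner ℝ (ψ x • e) (v.grad x) =
    -∫ x, v.fn x * inner ℝ (gradient ψ x) e) (isClosed_eq ?_ hR.neg) (fun φ hφ => ?_) u
  · simp only [hL]
    exact continuous_const.inner D12.continuous_grad
  · have h1 : ∫ x, inner ℝ (ψ x • e) ((ofTest φ hφ).grad x) =
        ∫ x, ψ x * fderiv ℝ φ x e := by
      refine integral_congr_ae ?_
      filter_upwards [grad_ofTest hφ] with x hx
      rw [hx, fderiv_apply_eq_inner_gradient, real_inner_smul_left, real_inner_comm]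
    have h2 : ∫ x, (ofTest φ hφ).fn x * inner ℝ (gradient ψ x) e =
        ∫ x, fderiv ℝ ψ x e * φ x := by
      refine integral_congr_ae ?_
      filter_upwards [fn_ofTest hφ] with x hx
      rw [hx, fderiv_apply_eq_inner_gradient, mul_comm]
    rw [h1, h2]
    have hc : ∀ {χ : E N → ℝ}, IsTest χ → Continuous fun x => fderiv ℝ χ x e := fun hχ =>
      (hχ.1.continuous_fderiv (by simp)).clm_apply continuous_const
    refine integral_mul_fderiv_eq_neg_fderiv_mul_of_integrable ?_ ?_ ?_
      (fun x _ => hψ.differentiable x) (fun x _ => hφ.differentiable x)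
    · exact ((hc hψ).mul hφ.1.continuous).integrable_of_hasCompactSupport hφ.2.mul_left
    · exact (hψ.1.continuous.mul (hc hφ)).integrable_of_hasCompactSupport hψ.2.mul_right
    · exact (hψ.1.continuous.mul hφ.1.continuous).integrable_of_hasCompactSupport hφ.2.mul_left

/-- Elements of `D12` are pairs, so the second component must be recovered from the first: it is the
weak gradient, and the fundamental lemma of the calculus of variations makes it vanish with the
function. -/
theorem D12.eq_zero_of_fn_eq_zero {u : D12 N} (h : u.fn = 0) : u = 0 := by
  have hgrad : ∀ᵐ x, u.grad x = 0 := by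
    refine ae_eq_zero_of_integral_contDiff_smul_eq_zero
      ((Lp.memLp u.grad).locallyIntegrable (by norm_num)) fun ψ hψ1 hψ2 => ?_
    have hψ : IsTest ψ := ⟨hψ1, hψ2⟩
    have hint : Integrable fun x => ψ x • u.grad x :=
      memLp_one_iff_integrable.1 ((Lp.memLp u.grad).smul (hψ.memLp 2))
    refine ext_inner_left ℝ fun e => ?_
    rw [inner_zero_right, ← integral_inner hint]
    have h1 := integral_grad_mul u hψ e
    have h2 : ∫ x, u.fn x * inner ℝ (gradient ψ x) e = 0 := by
      rw [h]
      refine integral_eq_zero_of_ae ?_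
      filter_upwards [Lp.coeFn_zero ℝ (critLp N) (volume : Measure (E N))] with x hx
      rw [hx]
      simp
    rw [h2, neg_zero] at h1
    rw [← h1]
    refine integral_congr_ae (Eventually.of_forall fun x => ?_)
    simp only
    rw [real_inner_smul_left, real_inner_smul_right]
  have : u.grad = 0 := Lp.eq_zero_iff_ae_eq_zero.2 hgrad
  exact Subtype.ext (Prod.ext h this)

theorem D12.eq_zero_of_grad_eq_zero {u : D12 N} (h : u.grad = 0) : u = 0 := by
  obtain ⟨K, -, hK⟩ := exists_norm_fn_le N
  refine D12.eq_zero_of_fn_eq_zero (norm_le_zero_iff.1 ?_)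
  simpa [h] using hK u

theorem dirichlet_pos {u : D12 N} (hu : u ≠ 0) : 0 < dirichlet u := by
  rw [dirichlet_eq]
  have : u.grad ≠ 0 := fun h => hu (D12.eq_zero_of_grad_eq_zero h)
  have := norm_pos_iff.2 this
  positivity

theorem hardyInt_pos {s : ℝ} (hs0 : 0 ≤ s) (hs2 : s < 2) {u : D12 N} (hu : u ≠ 0) :
    0 < hardyInt s u := by
  rw [hardyInt_eq hs0 hs2]
  refine Real.rpow_pos_of_pos ((hsNorm_nonneg s u).lt_of_ne' fun h => hu ?_) _
  have h0 : eLpNorm u.fn (hsLp N s) (hardyMeasure N s) = 0 :=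
    ((ENNReal.toReal_eq_zero_iff _).1 h).resolve_right (memLp_fn hs0 hs2 u).eLpNorm_ne_top
  have h1 := (eLpNorm_eq_zero_iff (aestronglyMeasurable_fn u s) (hsLp_ne_zero hs2)).1 h0
  exact D12.eq_zero_of_fn_eq_zero (Lp.eq_zero_iff_ae_eq_zero.2
    ((absolutelyContinuous_hardyMeasure N s).ae_le h1))

theorem critInt_pos {u : D12 N} (hu : u ≠ 0) : 0 < critInt u := by
  rw [← hardyInt_zero]
  exact hardyInt_pos le_rfl two_pos hu

end Functionals

/-! ### Inequalities between powers -/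

section Scalar

/-- Bernoulli's inequality for `t^q` with exponent `p / q ≥ 1`. It compares the terms of different
homogeneity along a ray. -/
theorem rpow_sub_one_div_le {q p t : ℝ} (hq : 0 < q) (hqp : q ≤ p) (ht : 0 ≤ t) :
    (t ^ q - 1) / q ≤ (t ^ p - 1) / p := by
  have hp : 0 < p := hq.trans_le hqp
  have hx : 0 ≤ t ^ q := Real.rpow_nonneg ht q
  have h := one_add_mul_self_le_rpow_one_add (s := t ^ q - 1) (by linarith)
    ((one_le_div hq).2 hqp)
  rw [add_sub_cancel, ← Real.rpow_mul ht, mul_div_cancel₀ _ hq.ne'] at h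
  rw [le_div_iff₀ hp]
  calc (t ^ q - 1) / q * p = p / q * (t ^ q - 1) := by ring
    _ ≤ t ^ p - 1 := by linarith

theorem eventually_sum_rpow_sub_rpow_neg {l : ℕ} (d : ℝ) (b q : Fin l → ℝ) {p m : ℝ}
    (hp : 2 < p) (hq : ∀ i, q i < p) (hm : 0 < m) :
    ∀ᶠ t : ℝ in atTop, d * t ^ 2 + ∑ i, b i * t ^ q i - m * t ^ p < 0 := by
  have hz : ∀ r : ℝ, r < p → Tendsto (fun t : ℝ => t ^ (r - p)) atTop (𝓝 0) := by
    intro r hr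
    have := tendsto_rpow_neg_atTop (y := p - r) (by linarith)
    simpa using this
  have hlim : Tendsto (fun t : ℝ => d * t ^ ((2 : ℝ) - p) + ∑ i, b i * t ^ (q i - p) - m) atTop
      (𝓝 (d * 0 + ∑ i, b i * 0 - m)) :=
    (((hz 2 hp).const_mul d).add
      (tendsto_finsetSum _ fun i _ => (hz _ (hq i)).const_mul (b i))).sub_const m
  have hneg : d * 0 + ∑ i, b i * 0 - m < 0 := by simpa using hm
  filter_upwards [hlim.eventually_lt_const hneg, eventually_gt_atTop 0] with t ht ht0
  have htp : 0 < t ^ p := Real.rpow_pos_of_pos ht0 p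
  have e : d * t ^ 2 + ∑ i, b i * t ^ q i - m * t ^ p =
      t ^ p * (d * t ^ ((2 : ℝ) - p) + ∑ i, b i * t ^ (q i - p) - m) := by
    have h1 : ∀ r : ℝ, t ^ p * t ^ (r - p) = t ^ r := fun r => by
      rw [← Real.rpow_add ht0]
      congr 1
      ring
    rw [mul_sub, mul_add, Finset.mul_sum, mul_left_comm, h1, Real.rpow_two, mul_comm m]
    simp only [mul_left_comm (t ^ p), h1]
  rw [e]
  exact mul_neg_of_pos_of_neg htp ht

end Scalar

/-! ### The level `S^{N/2} / N` and the limiting functional -/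

section Level

variable (N : ℕ) [Fact (3 ≤ N)]

/-- The level `S^{N/2} / N`. -/
def groundLevel : ℝ := sobolevConst N ^ ((N : ℝ) / 2) / N

theorem natCast_pos : (0 : ℝ) < N := by linarith [natCast_sub_two_pos N]

theorem half_sub_inv_critExp : 1 / 2 - 1 / critExp N = 1 / (N : ℝ) := by
  have h1 := natCast_sub_two_pos N
  have h2 := natCast_pos N
  unfold critExp
  field_simp
  ring

theorem one_sub_two_div_critExp : 1 - 2 / critExp N = 2 / (N : ℝ) := by
  have := half_sub_inv_critExp N
  calc 1 - 2 / critExp N = 2 * (1 / 2 - 1 / critExp N) := by ring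
    _ = 2 / (N : ℝ) := by rw [this]; ring

theorem exists_isTest_ne_zero :
    ∃ (φ : E N → ℝ) (hφ : IsTest φ), ofTest φ hφ ≠ 0 := by
  let b : ContDiffBump (0 : E N) := ⟨1, 2, one_pos, one_lt_two⟩
  have hb : IsTest (b : E N → ℝ) := ⟨b.contDiff, b.hasCompactSupport⟩
  refine ⟨b, hb, fun h => ?_⟩
  have h1 : (b : E N → ℝ) =ᵐ[volume] fun _ => 0 := by
    have h2 := fn_ofTest hb
    rw [h, D12.fn_zero] at h2
    exact h2.symm.trans (Lp.coeFn_zero _ _ _)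
  have h3 := (Continuous.ae_eq_iff_eq volume b.continuous continuous_const).1 h1
  have h4 : b 0 = 1 := b.one_of_mem_closedBall (by simp [b])
  rw [h3] at h4
  exact zero_ne_one h4

theorem bddBelow_sobolev_quotients :
    BddBelow {q | ∃ u : D12 N, u ≠ 0 ∧ q = dirichlet u / critInt u ^ (2 / critExp N)} := by
  refine ⟨0, ?_⟩
  rintro q ⟨u, -, rfl⟩
  have := dirichlet_nonneg u
  have := critInt_nonneg u
  positivity

theorem sobolevConst_pos : 0 < sobolevConst N := by
  obtain ⟨K, hK, h⟩ := exists_hsNorm_le (N := N) le_rfl two_pos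
  obtain ⟨φ, hφ, hne⟩ := exists_isTest_ne_zero N
  -- `K ^ 2 + 1` instead of `K ^ 2`, since `K` is only known to be nonnegative.
  have hpos : 0 < 1 / (K ^ 2 + 1) := by positivity
  refine hpos.trans_le (le_csInf ⟨_, ofTest φ hφ, hne, rfl⟩ ?_)
  rintro q ⟨u, hu, rfl⟩
  have hC := critInt_pos hu
  have hD := dirichlet_pos hu
  have e : critInt u ^ (2 / critExp N) = hsNorm 0 u ^ 2 := by
    rw [← hardyInt_zero, hardyInt_eq le_rfl two_pos, ← Real.rpow_mul (hsNorm_nonneg 0 u),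
      hsExp_zero, mul_div_cancel₀ _ (critExp_pos N).ne', Real.rpow_two]
  have h2 : hsNorm 0 u ^ 2 ≤ K ^ 2 * dirichlet u := by
    rw [dirichlet_eq, ← mul_pow]
    exact pow_le_pow_left₀ (hsNorm_nonneg 0 u) (h u) 2
  rw [div_le_div_iff₀ (by positivity) (Real.rpow_pos_of_pos hC _), e]
  nlinarith

theorem groundLevel_pos : 0 < groundLevel N :=
  div_pos (Real.rpow_pos_of_pos (sobolevConst_pos N) _) (natCast_pos N)

variable {N}

theorem sobolevConst_le {u : D12 N} (hu : u ≠ 0) :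
    sobolevConst N ≤ dirichlet u / critInt u ^ (2 / critExp N) :=
  csInf_le (bddBelow_sobolev_quotients N) ⟨u, hu, rfl⟩

/-- When `D = C` the Sobolev quotient is `D^{1 - 2/p} = D^{2/N}`; raise the bound by `S` to the
power `N/2`. -/
theorem groundLevel_le_of_eq {u : D12 N} (hu : u ≠ 0) (h : dirichlet u = critInt u) :
    groundLevel N ≤ dirichlet u / N := by
  have hD := dirichlet_pos hu
  have hN := natCast_pos N
  have h1 := sobolevConst_le hu
  rw [← h] at h1
  nth_rewrite 1 [← Real.rpow_one (dirichlet u)] at h1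
  rw [← Real.rpow_sub hD, one_sub_two_div_critExp] at h1
  have h2 := Real.rpow_le_rpow (sobolevConst_pos N).le h1 (by positivity : 0 ≤ (N : ℝ) / 2)
  rw [← Real.rpow_mul hD.le, div_mul_div_cancel₀ hN.ne', div_self two_ne_zero,
    Real.rpow_one] at h2
  exact div_le_div_of_nonneg_right h2 hN.le

/-- The scaling `t = (D/C)^{1/(p-2)}` balances the two integrals, and `2/(p-2) = N/2 - 1` turns `t^2
D` into a power of the Sobolev quotient. -/
theorem exists_smul_balanced {u : D12 N} (hu : u ≠ 0) :
    ∃ t : ℝ, 0 < t ∧ t ^ 2 * dirichlet u = t ^ critExp N * critInt u ∧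
      t ^ 2 * dirichlet u / N =
        (dirichlet u / critInt u ^ (2 / critExp N)) ^ ((N : ℝ) / 2) / N := by
  have hD := dirichlet_pos hu
  have hC := critInt_pos hu
  have hp := two_lt_critExp N
  have hp' : critExp N - 2 ≠ 0 := by linarith
  have hN := natCast_pos N
  have hN2 := natCast_sub_two_pos N
  have hq : 0 < dirichlet u / critInt u := by positivity
  refine ⟨(dirichlet u / critInt u) ^ (1 / (critExp N - 2)), by positivity, ?_, ?_⟩
  · rw [← Real.rpow_two, ← Real.rpow_mul hq.le, ← Real.rpow_mul hq.le]
    have : 1 / (critExp N - 2) * critExp N = 1 / (critExp N - 2) * 2 + 1 := by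
      field_simp
      ring
    rw [this, Real.rpow_add hq, Real.rpow_one]
    field_simp
  · congr 1
    rw [← Real.rpow_two, ← Real.rpow_mul hq.le, Real.div_rpow hD.le hC.le,
      Real.div_rpow hD.le (by positivity), ← Real.rpow_mul hC.le]
    have e1 : 1 / (critExp N - 2) * 2 = (N : ℝ) / 2 - 1 := by
      unfold critExp
      have : 2 * (N : ℝ) / (N - 2) - 2 = 4 / (N - 2) := by
        field_simp
        ring
      rw [this]
      field_simp
      ring
    have e2 : 2 / critExp N * ((N : ℝ) / 2) = (N : ℝ) / 2 - 1 := by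
      unfold critExp
      field_simp
    rw [e1, e2, Real.rpow_sub_one hD.ne']
    field_simp

/-- Along the rays the limiting energy is at most `(D / C^{2/2^*})^{N/2} / N`. -/
theorem limiting_energy_le {u : D12 N} (hu : u ≠ 0) {t : ℝ} (ht : 0 ≤ t) :
    1 / 2 * (t ^ 2 * dirichlet u) - 1 / critExp N * (t ^ critExp N * critInt u) ≤
      (dirichlet u / critInt u ^ (2 / critExp N)) ^ ((N : ℝ) / 2) / N := by
  obtain ⟨t₀, ht₀, h1, h2⟩ := exists_smul_balanced hu
  have hp := two_lt_critExp N
  have hp0 := critExp_pos N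
  have hD := dirichlet_pos hu
  rw [← h2]
  -- Measured from the balanced point, the claim is the power inequality with exponents 2 and `2^*`.
  set r := t / t₀ with hr
  have hr0 : 0 ≤ r := by positivity
  have htr : t = r * t₀ := by rw [hr, div_mul_cancel₀ _ ht₀.ne']
  have hb := rpow_sub_one_div_le two_pos hp.le hr0
  rw [htr, mul_pow, Real.mul_rpow hr0 ht₀.le, mul_assoc, mul_assoc, ← h1]
  set A := t₀ ^ 2 * dirichlet u with hA
  have hA0 : 0 ≤ A := by positivity
  rw [Real.rpow_two] at hb
  have hb2 := mul_le_mul_of_nonneg_right hb hA0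
  have e : A / N = (1 / 2 - 1 / critExp N) * A := by
    rw [half_sub_inv_critExp]
    ring
  rw [e]
  have e3 : (r ^ critExp N - 1) / critExp N * A =
      1 / critExp N * (r ^ critExp N * A) - 1 / critExp N * A := by ring
  linarith

end Level

/-! ### The energy along rays and on the Nehari manifold -/

section Energy

variable {N : ℕ} [Fact (3 ≤ N)] {l : ℕ} {s lam : Fin l → ℝ}

theorem energy_zero (hs : ∀ i, 0 < s i ∧ s i < 2) : energy s lam (0 : D12 N) = 0 := by
  have hH : ∀ r : ℝ, 0 ≤ r → r < 2 → hardyInt r (0 : D12 N) = 0 := fun r h0 h2 => by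
    have h := hardyInt_smul (N := N) h0 h2 0 0
    rw [zero_smul, abs_zero, Real.zero_rpow (hsExp_pos N h2).ne', zero_mul] at h
    exact h
  have hC : critInt (0 : D12 N) = 0 := by rw [← hardyInt_zero, hH 0 le_rfl two_pos]
  have hD : dirichlet (0 : D12 N) = 0 := by simp [dirichlet_eq]
  simp [energy, hD, hC, hH _ (hs _).1.le (hs _).2]

theorem continuous_energy (hs : ∀ i, 0 < s i ∧ s i < 2) :
    Continuous (energy s lam : D12 N → ℝ) := by
  refine ((continuous_const.mul continuous_dirichlet).sub
    (continuous_finsetSum _ fun i _ => continuous_const.mul ?_)).sub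
      (continuous_const.mul continuous_critInt)
  exact continuous_hardyInt (hs i).1.le (hs i).2

theorem energy_smul (hs : ∀ i, 0 < s i ∧ s i < 2) {t : ℝ} (ht : 0 ≤ t) (u : D12 N) :
    energy s lam (t • u) = 1 / 2 * (t ^ 2 * dirichlet u)
      - ∑ i, lam i / hsExp N (s i) * (t ^ hsExp N (s i) * hardyInt (s i) u)
      - 1 / critExp N * (t ^ critExp N * critInt u) := by
  simp only [energy, dirichlet_smul, critInt_smul, hardyInt_smul (hs _).1.le (hs _).2,
    abs_of_nonneg ht]

/-- The source of every strict inequality: the limiting energy `D/N` already reaches the level, and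
a nonempty sum of positive Hardy terms is added to it. -/
theorem groundLevel_lt_energy_of_eq (hl : 0 < l) (hs : ∀ i, 0 < s i ∧ s i < 2)
    (hlam : ∀ i, lam i < 0) {u : D12 N} (hu : u ≠ 0) (h : dirichlet u = critInt u) :
    groundLevel N < energy s lam u := by
  have h1 := groundLevel_le_of_eq hu h
  have : Nonempty (Fin l) := ⟨⟨0, hl⟩⟩
  have h2 : 0 < ∑ i, -(lam i / hsExp N (s i) * hardyInt (s i) u) := by
    refine Finset.sum_pos (fun i _ => ?_) Finset.univ_nonempty
    have h3 := hardyInt_pos (hs i).1.le (hs i).2 hu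
    have h4 := div_neg_of_neg_of_pos (hlam i) (hsExp_pos N (hs i).2)
    exact neg_pos.2 (mul_neg_of_neg_of_pos h4 h3)
  rw [Finset.sum_neg_distrib] at h2
  have e : dirichlet u / N = 1 / 2 * dirichlet u - 1 / critExp N * dirichlet u := by
    rw [← sub_mul, half_sub_inv_critExp]
    ring
  unfold energy
  rw [← h]
  linarith

theorem exists_groundLevel_lt_energy_smul (hl : 0 < l) (hs : ∀ i, 0 < s i ∧ s i < 2)
    (hlam : ∀ i, lam i < 0) {u : D12 N} (hu : u ≠ 0) :
    ∃ t : ℝ, 0 ≤ t ∧ groundLevel N < energy s lam (t • u) := by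
  obtain ⟨t, ht, h, -⟩ := exists_smul_balanced hu
  refine ⟨t, ht.le, groundLevel_lt_energy_of_eq hl hs hlam (smul_ne_zero ht.ne' hu) ?_⟩
  rw [dirichlet_smul, critInt_smul, abs_of_pos ht, h]

/-- A point of the Nehari manifold maximises the energy along its ray. -/
theorem energy_smul_le_of_mem_nehari (hs : ∀ i, 0 < s i ∧ s i < 2) (hlam : ∀ i, lam i < 0)
    {u : D12 N} (hu : u ∈ nehari N s lam) {t : ℝ} (ht : 0 ≤ t) :
    energy s lam (t • u) ≤ energy s lam u := by
  have hp := two_lt_critExp N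
  -- `B` dominates `(t^r - 1)/r` for every exponent `r` that occurs. Replacing all these factors by
  -- `B` bounds the energy difference by `B` times the Nehari expression, which is zero.
  set B := (t ^ critExp N - 1) / critExp N with hB
  have h1 : (t ^ 2 - 1) / 2 * dirichlet u ≤ B * dirichlet u := by
    have := rpow_sub_one_div_le two_pos hp.le ht
    rw [Real.rpow_two] at this
    exact mul_le_mul_of_nonneg_right this (dirichlet_nonneg u)
  have h2 : ∑ i, (t ^ hsExp N (s i) - 1) / hsExp N (s i) * (-lam i * hardyInt (s i) u) ≤
      ∑ i, B * (-lam i * hardyInt (s i) u) := by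
    refine Finset.sum_le_sum fun i _ => mul_le_mul_of_nonneg_right
      (rpow_sub_one_div_le (hsExp_pos N (hs i).2) (hsExp_lt_critExp N (hs i).1).le ht) ?_
    exact mul_nonneg (by linarith [hlam i]) (hardyInt_nonneg _ u)
  rw [← Finset.mul_sum] at h2
  have h3 : ∑ i, -lam i * hardyInt (s i) u = critInt u - dirichlet u := by
    have := hu.2
    simp only [neg_mul, Finset.sum_neg_distrib]
    linarith
  have h4 : ∑ i, (t ^ hsExp N (s i) - 1) / hsExp N (s i) * (-lam i * hardyInt (s i) u) =
      ∑ i, lam i / hsExp N (s i) * hardyInt (s i) u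
        - ∑ i, lam i / hsExp N (s i) * (t ^ hsExp N (s i) * hardyInt (s i) u) := by
    rw [← Finset.sum_sub_distrib]
    exact Finset.sum_congr rfl fun i _ => by ring
  rw [h3, h4] at h2
  have h5 : B * critInt u = 1 / critExp N * (t ^ critExp N * critInt u)
      - 1 / critExp N * critInt u := by rw [hB]; ring
  rw [energy_smul hs ht]
  unfold energy
  nlinarith

theorem groundLevel_lt_energy_of_mem_nehari (hl : 0 < l) (hs : ∀ i, 0 < s i ∧ s i < 2)
    (hlam : ∀ i, lam i < 0) {u : D12 N} (hu : u ∈ nehari N s lam) :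
    groundLevel N < energy s lam u := by
  obtain ⟨t, ht, h⟩ := exists_groundLevel_lt_energy_smul hl hs hlam hu.1
  exact h.trans_le (energy_smul_le_of_mem_nehari hs hlam hu ht)

/-- Among the weights `1/2`, `1/q_i`, `1/p` the last is the smallest and goes with the only negative
contribution, so `p` times the energy is at least the Nehari expression. -/
theorem dirichlet_sub_sum_lt_critInt (hs : ∀ i, 0 < s i ∧ s i < 2) (hlam : ∀ i, lam i < 0)
    {u : D12 N} (hu : energy s lam u < 0) :
    dirichlet u - ∑ i, lam i * hardyInt (s i) u < critInt u := by
  have hp := two_lt_critExp N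
  have hp0 := critExp_pos N
  have h1 : ∑ i, lam i / hsExp N (s i) * hardyInt (s i) u ≤
      1 / critExp N * ∑ i, lam i * hardyInt (s i) u := by
    rw [Finset.mul_sum]
    refine Finset.sum_le_sum fun i _ => ?_
    have h2 : 1 / critExp N ≤ 1 / hsExp N (s i) :=
      one_div_le_one_div_of_le (hsExp_pos N (hs i).2) (hsExp_lt_critExp N (hs i).1).le
    have h3 : lam i * hardyInt (s i) u ≤ 0 :=
      mul_nonpos_of_nonpos_of_nonneg (hlam i).le (hardyInt_nonneg _ u)
    calc lam i / hsExp N (s i) * hardyInt (s i) u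
        = 1 / hsExp N (s i) * (lam i * hardyInt (s i) u) := by ring
      _ ≤ _ := mul_le_mul_of_nonpos_right h2 h3
  have h4 : 1 / critExp N * dirichlet u ≤ 1 / 2 * dirichlet u :=
    mul_le_mul_of_nonneg_right (one_div_le_one_div_of_le two_pos hp.le) (dirichlet_nonneg u)
  have h5 : 1 / critExp N * (dirichlet u - ∑ i, lam i * hardyInt (s i) u - critInt u) < 0 := by
    unfold energy at hu
    linarith
  have := neg_of_mul_neg_right h5 (by positivity)
  linarith

theorem dirichlet_lt_critInt (hs : ∀ i, 0 < s i ∧ s i < 2) (hlam : ∀ i, lam i < 0)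
    {u : D12 N} (hu : energy s lam u < 0) : dirichlet u < critInt u := by
  have h1 := dirichlet_sub_sum_lt_critInt hs hlam hu
  have h2 : ∑ i, lam i * hardyInt (s i) u ≤ 0 := Finset.sum_nonpos fun i _ =>
    mul_nonpos_of_nonpos_of_nonneg (hlam i).le (hardyInt_nonneg _ u)
  linarith

theorem ne_zero_of_energy_neg (hs : ∀ i, 0 < s i ∧ s i < 2)
    {u : D12 N} (hu : energy s lam u < 0) : u ≠ 0 := by
  rintro rfl
  rw [energy_zero hs] at hu
  exact lt_irrefl _ hu

/-- The energy is eventually negative along rays, uniformly over sets on which the Dirichlet and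
Hardy integrals are bounded above and the critical integral is bounded below. -/
theorem eventually_energy_smul_neg (hs : ∀ i, 0 < s i ∧ s i < 2) (hlam : ∀ i, lam i < 0)
    (d m : ℝ) (b : Fin l → ℝ) (hm : 0 < m) :
    ∀ᶠ t : ℝ in atTop, ∀ u : D12 N, dirichlet u ≤ d → (∀ i, hardyInt (s i) u ≤ b i) →
      m ≤ critInt u → energy s lam (t • u) < 0 := by
  have hp0 := critExp_pos N
  filter_upwards [eventually_sum_rpow_sub_rpow_neg (1 / 2 * d)
    (fun i => -(lam i / hsExp N (s i)) * b i) (fun i => hsExp N (s i)) (two_lt_critExp N)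
    (fun i => hsExp_lt_critExp N (hs i).1) (by positivity : 0 < 1 / critExp N * m),
    eventually_ge_atTop 0] with t ht ht0 u hd hb hC
  refine lt_of_le_of_lt ?_ ht
  rw [energy_smul hs ht0, ← sub_nonneg]
  -- The gap between the scalar bound and the energy is the sum of the three nonnegative quantities
  -- `h1`, `h2`, `h3`.
  have h1 : 0 ≤ 1 / 2 * t ^ 2 * (d - dirichlet u) := by
    have : 0 ≤ d - dirichlet u := by linarith
    positivity
  have h2 : 0 ≤ 1 / critExp N * t ^ critExp N * (critInt u - m) := by
    have : 0 ≤ critInt u - m := by linarith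
    positivity
  have h3 : 0 ≤ ∑ i, -(lam i / hsExp N (s i)) * t ^ hsExp N (s i) * (b i - hardyInt (s i) u) := by
    refine Finset.sum_nonneg fun i _ => mul_nonneg (mul_nonneg ?_ (by positivity)) ?_
    · have := div_neg_of_neg_of_pos (hlam i) (hsExp_pos N (hs i).2)
      linarith
    · linarith [hb i]
  have h4 : ∑ i, -(lam i / hsExp N (s i)) * t ^ hsExp N (s i) * (b i - hardyInt (s i) u) =
      ∑ i, -(lam i / hsExp N (s i)) * b i * t ^ hsExp N (s i)
        + ∑ i, lam i / hsExp N (s i) * (t ^ hsExp N (s i) * hardyInt (s i) u) := by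
    rw [← Finset.sum_add_distrib]
    exact Finset.sum_congr rfl fun i _ => by ring
  rw [h4] at h3
  linarith

theorem eventually_energy_smul_neg_of_ne_zero (hs : ∀ i, 0 < s i ∧ s i < 2)
    (hlam : ∀ i, lam i < 0) {u : D12 N} (hu : u ≠ 0) :
    ∀ᶠ t : ℝ in atTop, energy s lam (t • u) < 0 := by
  filter_upwards [eventually_energy_smul_neg (N := N) hs hlam (dirichlet u) (critInt u)
    (fun i => hardyInt (s i) u) (critInt_pos hu)] with t ht
  exact ht u le_rfl (fun i => le_rfl) le_rfl

theorem exists_energy_neg (hs : ∀ i, 0 < s i ∧ s i < 2) (hlam : ∀ i, lam i < 0) :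
    ∃ u : D12 N, energy s lam u < 0 := by
  obtain ⟨φ, hφ, h⟩ := exists_isTest_ne_zero N
  obtain ⟨t, ht⟩ := (eventually_energy_smul_neg_of_ne_zero hs hlam h).exists
  exact ⟨_, ht⟩

/-- Every ray meets the Nehari manifold. -/
theorem exists_smul_mem_nehari (hs : ∀ i, 0 < s i ∧ s i < 2) (hlam : ∀ i, lam i < 0)
    {u : D12 N} (hu : u ≠ 0) : ∃ t : ℝ, 0 < t ∧ t • u ∈ nehari N s lam := by
  obtain ⟨t₁, ht₁, h1, -⟩ := exists_smul_balanced hu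
  obtain ⟨t₂, ht₂, hlt⟩ := ((eventually_energy_smul_neg_of_ne_zero hs hlam hu).and
    (eventually_gt_atTop t₁)).exists
  set g : ℝ → ℝ := fun t => dirichlet (t • u) - ∑ i, lam i * hardyInt (s i) (t • u)
    - critInt (t • u) with hg
  have hgc : Continuous g := by
    have hsm : Continuous fun t : ℝ => t • u := continuous_id.smul continuous_const
    refine ((continuous_dirichlet.comp hsm).sub (continuous_finsetSum _ fun i _ =>
      continuous_const.mul ?_)).sub (continuous_critInt.comp hsm)
    exact (continuous_hardyInt (hs i).1.le (hs i).2).comp hsm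
  have hg1 : 0 ≤ g t₁ := by
    have h2 : ∑ i, lam i * hardyInt (s i) (t₁ • u) ≤ 0 := Finset.sum_nonpos fun i _ =>
      mul_nonpos_of_nonpos_of_nonneg (hlam i).le (hardyInt_nonneg _ _)
    have h3 : dirichlet (t₁ • u) = critInt (t₁ • u) := by
      rw [dirichlet_smul, critInt_smul, abs_of_pos ht₁, h1]
    simp only [hg]
    linarith
  have hg2 : g t₂ ≤ 0 := by
    have := dirichlet_sub_sum_lt_critInt hs hlam ht₂
    simp only [hg]
    linarith
  -- The Nehari expression is nonnegative at the balanced point `t₁` and negative where the energy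
  -- is negative, so it vanishes in between.
  obtain ⟨t, ht, h0⟩ := intermediate_value_Icc' hlt.le hgc.continuousOn ⟨hg2, hg1⟩
  have htpos := ht₁.trans_le ht.1
  exact ⟨t, htpos, smul_ne_zero htpos.ne' hu, h0⟩

end Energy

/-! ### Translated test functions and the upper bound -/

section Translation

variable {N : ℕ}

theorem IsTest.translate {φ : E N → ℝ} (hφ : IsTest φ) (y : E N) :
    IsTest fun x => φ (x - y) :=
  ⟨hφ.1.comp (contDiff_id.sub contDiff_const), hφ.2.comp_homeomorph (Homeomorph.subRight y)⟩

theorem gradient_translate (φ : E N → ℝ) (y x : E N) :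
    gradient (fun x => φ (x - y)) x = gradient φ (x - y) := by
  unfold gradient
  rw [fderiv_comp_sub]

variable [Fact (3 ≤ N)]

theorem dirichlet_ofTest {φ : E N → ℝ} (hφ : IsTest φ) :
    dirichlet (ofTest φ hφ) = ∫ x, ‖gradient φ x‖ ^ 2 := by
  refine integral_congr_ae ?_
  filter_upwards [grad_ofTest hφ] with x hx
  rw [hx]

theorem critInt_ofTest {φ : E N → ℝ} (hφ : IsTest φ) :
    critInt (ofTest φ hφ) = ∫ x, |φ x| ^ critExp N := by
  refine integral_congr_ae ?_
  filter_upwards [fn_ofTest hφ] with x hx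
  rw [hx]

theorem hardyInt_ofTest {φ : E N → ℝ} (hφ : IsTest φ) (s : ℝ) :
    hardyInt s (ofTest φ hφ) = ∫ x, |φ x| ^ hsExp N s / ‖x‖ ^ s := by
  refine integral_congr_ae ?_
  filter_upwards [fn_ofTest hφ] with x hx
  rw [hx]

theorem dirichlet_translate {φ : E N → ℝ} (hφ : IsTest φ) (y : E N) :
    dirichlet (ofTest _ (hφ.translate y)) = dirichlet (ofTest φ hφ) := by
  simp only [dirichlet_ofTest, gradient_translate]
  exact integral_sub_right_eq_self (fun x => ‖gradient φ x‖ ^ 2) y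

theorem critInt_translate {φ : E N → ℝ} (hφ : IsTest φ) (y : E N) :
    critInt (ofTest _ (hφ.translate y)) = critInt (ofTest φ hφ) := by
  simp only [critInt_ofTest]
  exact integral_sub_right_eq_self (fun x => |φ x| ^ critExp N) y

/-- On the support of the translate `|x| ≥ |y| - R ≥ L`, so the weight is at most `L^{-s}` there. -/
theorem hardyInt_translate_le {φ : E N → ℝ} (hφ : IsTest φ) {s : ℝ} (hs0 : 0 ≤ s) (hs2 : s < 2)
    {y : E N} {R L : ℝ} (hR : ∀ x, φ x ≠ 0 → ‖x‖ ≤ R) (hL : 0 < L) (hy : R + L ≤ ‖y‖) :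
    hardyInt s (ofTest _ (hφ.translate y)) ≤ L ^ (-s) * ∫ x, |φ x| ^ hsExp N s := by
  have hq := hsExp_pos N hs2
  have hint : Integrable fun x => |φ x| ^ hsExp N s := by
    have := (hφ.memLp (hsLp N s)).integrable_norm_rpow (hsLp_ne_zero hs2) (hsLp_ne_top N s)
    simpa [toReal_hsLp hs2] using this
  rw [hardyInt_ofTest, ← integral_sub_right_eq_self (fun x => |φ x| ^ hsExp N s) y,
    ← integral_const_mul]
  refine integral_mono_of_nonneg (Eventually.of_forall fun x => by positivity)
    ((hint.comp_sub_right y).const_mul _) (Eventually.of_forall fun x => ?_)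
  by_cases hx : φ (x - y) = 0
  · simp [hx, Real.zero_rpow hq.ne']
  · have h1 := hR _ hx
    have h2 : L ≤ ‖x‖ := by
      have := norm_sub_norm_le y x
      rw [norm_sub_rev] at this
      linarith
    simp only
    rw [Real.rpow_neg hL.le, div_eq_inv_mul]
    gcongr

/-- A test function can be translated so far that its Hardy integrals are small. -/
theorem exists_translate_hardyInt_le {φ : E N → ℝ} (hφ : IsTest φ) {l : ℕ} {s : Fin l → ℝ}
    (hs : ∀ i, 0 < s i ∧ s i < 2) {η : ℝ} (hη : 0 < η) :
    ∃ y : E N, ∀ i, hardyInt (s i) (ofTest _ (hφ.translate y)) ≤ η := by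
  obtain ⟨R, hR⟩ := hφ.2.isBounded.exists_norm_le
  have hev : ∀ᶠ L : ℝ in atTop, ∀ i, L ^ (-s i) * ∫ x, |φ x| ^ hsExp N (s i) ≤ η := by
    refine eventually_all.2 fun i => ?_
    have := (tendsto_rpow_neg_atTop (hs i).1).mul_const (∫ x, |φ x| ^ hsExp N (s i))
    rw [zero_mul] at this
    exact (this.eventually_lt_const hη).mono fun _ h => h.le
  obtain ⟨L, hL, hL0⟩ := (hev.and (eventually_gt_atTop 0)).exists
  have := nontrivial_E N
  obtain ⟨y, hy⟩ := NormedSpace.exists_lt_norm ℝ (E N) (R + L)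
  refine ⟨y, fun i => (hardyInt_translate_le hφ (hs i).1.le (hs i).2 (fun x hx => ?_) hL0
    hy.le).trans (hL i)⟩
  exact hR x (subset_tsupport _ hx)

/-- Density of test functions and continuity of the quotient away from 0. Bounded support is what
lets translation reduce the Hardy integrals. -/
theorem exists_isTest_quotient_lt {a : ℝ} (ha : sobolevConst N < a) :
    ∃ (φ : E N → ℝ) (hφ : IsTest φ), ofTest φ hφ ≠ 0 ∧
      dirichlet (ofTest φ hφ) / critInt (ofTest φ hφ) ^ (2 / critExp N) < a := by
  obtain ⟨φ₀, hφ₀, hne⟩ := exists_isTest_ne_zero N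
  obtain ⟨q, ⟨u, hu, rfl⟩, hq⟩ := exists_lt_of_csInf_lt
    (s := {q | ∃ u : D12 N, u ≠ 0 ∧ q = dirichlet u / critInt u ^ (2 / critExp N)})
    ⟨_, ofTest φ₀ hφ₀, hne, rfl⟩ ha
  obtain ⟨φ, hφ, hlim⟩ := exists_seq_ofTest_tendsto u
  have hC := critInt_pos hu
  have hcont : ContinuousAt (fun v : D12 N => dirichlet v / critInt v ^ (2 / critExp N)) u :=
    continuous_dirichlet.continuousAt.div
      (continuous_critInt.continuousAt.rpow_const (Or.inl hC.ne'))
      (Real.rpow_pos_of_pos hC _).ne'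
  have h1 := (hcont.tendsto.comp hlim).eventually_lt_const hq
  have h2 := hlim.eventually_ne hu
  obtain ⟨n, hn1, hn2⟩ := (h1.and h2).exists
  exact ⟨φ n, hφ n, hn2, hn1⟩

/-- There are rays whose maximal energy is arbitrarily close to the ground level. -/
theorem exists_ray_energy_lt {l : ℕ} {s lam : Fin l → ℝ} (hs : ∀ i, 0 < s i ∧ s i < 2)
    (hlam : ∀ i, lam i < 0) {c : ℝ} (hc : groundLevel N < c) :
    ∃ V : D12 N, V ≠ 0 ∧ ∀ t : ℝ, 0 ≤ t → energy s lam (t • V) < c := by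
  have hS := sobolevConst_pos N
  have hcont : ContinuousAt (fun x : ℝ => x ^ ((N : ℝ) / 2) / N) (sobolevConst N) :=
    (continuousAt_id.rpow_const (Or.inl hS.ne')).div_const _
  obtain ⟨a, ha, hSa⟩ := ((hcont.tendsto.eventually_lt_const hc).filter_mono
    nhdsWithin_le_nhds |>.and (self_mem_nhdsWithin (s := Ioi (sobolevConst N)))).exists
  obtain ⟨φ, hφ, hne, hquot⟩ := exists_isTest_quotient_lt hSa
  set u := ofTest φ hφ with hu
  have hN := natCast_pos N
  have hc0 : 0 < c := (groundLevel_pos N).trans hc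
  have hD := dirichlet_nonneg u
  have hC := critInt_pos hne
  set M := (dirichlet u / critInt u ^ (2 / critExp N)) ^ ((N : ℝ) / 2) / N with hM
  have hMc : M < c := by
    refine lt_of_le_of_lt ?_ ha
    rw [hM]
    have : 0 ≤ dirichlet u / critInt u ^ (2 / critExp N) := by positivity
    gcongr
  -- `T` is fixed before the translation: it serves every function with these bounds on `D`, `C` and
  -- Hardy integrals at most 1. Only `[0, T]` then remains to be controlled.
  obtain ⟨T, hT, hT0⟩ := ((eventually_forall_ge_atTop.2 (eventually_energy_smul_neg (N := N) hs
    hlam (dirichlet u) (critInt u) (fun _ => 1) hC)).and (eventually_ge_atTop 0)).exists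
  set B := ∑ i, -(lam i / hsExp N (s i)) * T ^ hsExp N (s i) with hB
  have hcoef : ∀ i, 0 ≤ -(lam i / hsExp N (s i)) := fun i => by
    have := div_neg_of_neg_of_pos (hlam i) (hsExp_pos N (hs i).2)
    linarith
  have hB0 : 0 ≤ B := Finset.sum_nonneg fun i _ => mul_nonneg (hcoef i) (by positivity)
  -- The bound 1 makes `T` applicable; the other keeps the Hardy contribution on `[0, T]`, at most
  -- `B * η`, below `c - M`.
  set η := min 1 ((c - M) / (2 * (B + 1))) with hη
  have hcM : 0 < c - M := by linarith
  have hη0 : 0 < η := lt_min one_pos (by positivity)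
  obtain ⟨y, hy⟩ := exists_translate_hardyInt_le hφ hs hη0
  set V := ofTest _ (hφ.translate y) with hV
  have hVD : dirichlet V = dirichlet u := dirichlet_translate hφ y
  have hVC : critInt V = critInt u := critInt_translate hφ y
  have hV0 : V ≠ 0 := by
    intro h
    have : critInt V = 0 := by
      rw [h, ← zero_smul ℝ (0 : D12 N), critInt_smul, abs_zero,
        Real.zero_rpow (critExp_pos N).ne', zero_mul]
    linarith
  refine ⟨V, hV0, fun t ht => ?_⟩
  rcases le_total T t with hTt | htT
  · exact (hT t hTt V hVD.le (fun i => (hy i).trans (min_le_left _ _)) hVC.ge).trans hc0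
  · have h1 := limiting_energy_le hV0 ht
    rw [hVD, hVC, ← hM] at h1
    have h2 : -∑ i, lam i / hsExp N (s i) * (t ^ hsExp N (s i) * hardyInt (s i) V) ≤ B * η := by
      rw [hB, Finset.sum_mul, ← Finset.sum_neg_distrib]
      refine Finset.sum_le_sum fun i _ => ?_
      have h3 : t ^ hsExp N (s i) * hardyInt (s i) V ≤ T ^ hsExp N (s i) * η :=
        mul_le_mul (Real.rpow_le_rpow ht htT (hsExp_pos N (hs i).2).le) (hy i)
          (hardyInt_nonneg _ _) (by positivity)
      have := mul_le_mul_of_nonneg_left h3 (hcoef i)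
      linarith
    have h4 : B * η < c - M := by
      have h5 : η ≤ (c - M) / (2 * (B + 1)) := min_le_right _ _
      have h6 : B * η ≤ (B + 1) * ((c - M) / (2 * (B + 1))) :=
        mul_le_mul (by linarith) h5 hη0.le (by linarith)
      have h7 : (B + 1) * ((c - M) / (2 * (B + 1))) = (c - M) / 2 := by
        field_simp
      linarith
    rw [energy_smul hs ht, hVD, hVC]
    linarith

end Translation

/-! ### Mountain-pass paths -/

section Paths

variable {N : ℕ} [Fact (3 ≤ N)] {l : ℕ} {s lam : Fin l → ℝ}

/-- Paths are continuous for the gradient norm only; the Sobolev inequality supplies continuity of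
the function component. -/
theorem continuous_of_continuous_grad {X : Type*} [TopologicalSpace X] {γ : X → D12 N}
    (h : Continuous fun t => (γ t).grad) : Continuous γ := by
  obtain ⟨K, hK, hle⟩ := exists_norm_fn_le N
  refine Continuous.subtype_mk (Continuous.prodMk (?_ : Continuous fun t => (γ t).fn) h) _
  refine continuous_iff_continuousAt.2 fun t => tendsto_iff_norm_sub_tendsto_zero.2 ?_
  have h0 := (tendsto_iff_norm_sub_tendsto_zero.1 (h.tendsto t)).const_mul K
  rw [mul_zero] at h0
  exact squeeze_zero (fun _ => norm_nonneg _) (fun r => hle (γ r - γ t)) h0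

/-- Near the origin the Dirichlet integral dominates the critical integral. -/
theorem exists_critInt_lt_dirichlet (N : ℕ) [Fact (3 ≤ N)] :
    ∃ r : ℝ, 0 < r ∧ ∀ u : D12 N, u ≠ 0 → ‖u.grad‖ < r → critInt u < dirichlet u := by
  obtain ⟨K, hK, h⟩ := exists_hsNorm_le (N := N) le_rfl two_pos
  have hp := two_lt_critExp N
  have hp0 := critExp_pos N
  have hlim : Tendsto (fun x : ℝ => K ^ critExp N * x ^ (critExp N - 2)) (𝓝 0) (𝓝 0) := by
    have h1 : ContinuousAt (fun x : ℝ => K ^ critExp N * x ^ (critExp N - 2)) 0 :=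
      continuousAt_const.mul (continuousAt_id.rpow_const (Or.inr (by linarith)))
    have h2 := h1.tendsto
    rwa [Real.zero_rpow (by linarith), mul_zero] at h2
  obtain ⟨r, hr, hball⟩ := Metric.eventually_nhds_iff.1 (hlim.eventually_lt_const one_pos)
  refine ⟨r, hr, fun u hu hur => ?_⟩
  have hg : 0 < ‖u.grad‖ := norm_pos_iff.2 fun h => hu (D12.eq_zero_of_grad_eq_zero h)
  have h1 := hball (y := ‖u.grad‖) (by simpa using hur)
  rw [← hardyInt_zero, hardyInt_eq le_rfl two_pos, hsExp_zero, dirichlet_eq]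
  calc hsNorm 0 u ^ critExp N ≤ (K * ‖u.grad‖) ^ critExp N :=
        Real.rpow_le_rpow (hsNorm_nonneg 0 u) (h u) hp0.le
    _ = K ^ critExp N * ‖u.grad‖ ^ (critExp N - 2) * ‖u.grad‖ ^ 2 := by
        rw [Real.mul_rpow hK hg.le, mul_assoc, ← Real.rpow_two, ← Real.rpow_add hg,
          sub_add_cancel]
    _ < 1 * ‖u.grad‖ ^ 2 := mul_lt_mul_of_pos_right h1 (by positivity)
    _ = ‖u.grad‖ ^ 2 := one_mul _

/-- Every path to a point of negative energy passes above the ground level. -/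
theorem exists_groundLevel_lt_energy_path (hl : 0 < l) (hs : ∀ i, 0 < s i ∧ s i < 2)
    (hlam : ∀ i, lam i < 0) {u₀ : D12 N} (hu₀ : energy s lam u₀ < 0)
    {γ : unitInterval → D12 N} (hγ : γ ∈ pathsTo u₀) :
    ∃ t, groundLevel N < energy s lam (γ t) := by
  obtain ⟨hgrad, h0, h1⟩ := hγ
  have hγc := continuous_of_continuous_grad hgrad
  obtain ⟨r, hr, hlt⟩ := exists_critInt_lt_dirichlet N
  by_contra! hcon
  have hne : ∀ t, γ t ≠ 0 → dirichlet (γ t) ≠ critInt (γ t) := fun t ht h =>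
    (hcon t).not_gt (groundLevel_lt_energy_of_eq hl hs hlam ht h)
  have hDc : Continuous fun t => dirichlet (γ t) := continuous_dirichlet.comp hγc
  have hCc : Continuous fun t => critInt (γ t) := continuous_critInt.comp hγc
  have hzero : ∀ t, γ t = 0 → dirichlet (γ t) = critInt (γ t) := by
    intro t ht
    rw [ht, ← zero_smul ℝ (0 : D12 N), critInt_smul, dirichlet_smul, abs_zero,
      Real.zero_rpow (critExp_pos N).ne']
    simp
  have hopen : IsOpen {t | dirichlet (γ t) < critInt (γ t)} := isOpen_lt hDc hCc
  -- If the path stays at or below the level, `D = C` occurs only at the origin, around which `C ≤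
  -- D`. So the complement is open as well, and the set `{D < C}` is clopen in the interval,
  -- contains 1 and misses 0.
  have hcompl : {t | dirichlet (γ t) < critInt (γ t)}ᶜ =
      {t | ‖(γ t).grad‖ < r} ∪ {t | critInt (γ t) < dirichlet (γ t)} := by
    ext t
    simp only [mem_compl_iff, mem_ofPred_eq, not_lt, mem_union]
    constructor
    · intro h
      by_cases ht : γ t = 0
      · left
        rw [ht, D12.grad_zero, norm_zero]
        exact hr
      · exact Or.inr (h.lt_of_ne (hne t ht).symm)
    · rintro (h | h)
      · by_cases ht : γ t = 0
        · exact (hzero t ht).ge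
        · exact (hlt _ ht h).le
      · exact h.le
  have hclopen : IsClopen {t | dirichlet (γ t) < critInt (γ t)} := by
    refine ⟨isOpen_compl_iff.1 ?_, hopen⟩
    rw [hcompl]
    exact (isOpen_lt hgrad.norm continuous_const).union (isOpen_lt hCc hDc)
  rcases isClopen_iff.1 hclopen with h | h
  · have : (1 : unitInterval) ∈ {t | dirichlet (γ t) < critInt (γ t)} := by
      simp only [mem_ofPred_eq, h1]
      exact dirichlet_lt_critInt hs hlam hu₀
    rw [h] at this
    exact this
  · have : (0 : unitInterval) ∈ {t | dirichlet (γ t) < critInt (γ t)} := by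
      rw [h]
      trivial
    exact (ne_of_lt this) (hzero 0 h0)

/-- `2^*` is the largest exponent and carries the only negative term, so for `t ≥ 1` the energy at
`t • u` is at most `t^{2^*}` times the energy at `u`. -/
theorem energy_smul_neg_of_one_le (hs : ∀ i, 0 < s i ∧ s i < 2) (hlam : ∀ i, lam i < 0)
    {u : D12 N} (hu : energy s lam u < 0) {t : ℝ} (ht : 1 ≤ t) : energy s lam (t • u) < 0 := by
  have hp := two_lt_critExp N
  have htp : 0 < t ^ critExp N := Real.rpow_pos_of_pos (by linarith) _
  refine lt_of_le_of_lt ?_ (mul_neg_of_pos_of_neg htp hu)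
  rw [energy_smul hs (by linarith)]
  have h1 : t ^ 2 * dirichlet u ≤ t ^ critExp N * dirichlet u := by
    refine mul_le_mul_of_nonneg_right ?_ (dirichlet_nonneg u)
    rw [← Real.rpow_two]
    exact Real.rpow_le_rpow_of_exponent_le ht hp.le
  have h2 : t ^ critExp N * ∑ i, lam i / hsExp N (s i) * hardyInt (s i) u ≤
      ∑ i, lam i / hsExp N (s i) * (t ^ hsExp N (s i) * hardyInt (s i) u) := by
    rw [Finset.mul_sum]
    refine Finset.sum_le_sum fun i _ => ?_
    have h3 : t ^ hsExp N (s i) * hardyInt (s i) u ≤ t ^ critExp N * hardyInt (s i) u :=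
      mul_le_mul_of_nonneg_right
        (Real.rpow_le_rpow_of_exponent_le ht (hsExp_lt_critExp N (hs i).1).le)
        (hardyInt_nonneg _ u)
    have h4 := div_neg_of_neg_of_pos (hlam i) (hsExp_pos N (hs i).2)
    rw [mul_left_comm]
    exact mul_le_mul_of_nonpos_left h3 h4.le
  unfold energy
  nlinarith

/-- After multiplication by a large factor, a segment avoiding the origin has negative energy. -/
theorem eventually_segment_energy_neg (hs : ∀ i, 0 < s i ∧ s i < 2) (hlam : ∀ i, lam i < 0)
    {f : unitInterval → D12 N} (hf : Continuous f) (h0 : ∀ t, f t ≠ 0) :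
    ∀ᶠ R : ℝ in atTop, ∀ t, energy s lam (R • f t) < 0 := by
  have hbdd : ∀ g : D12 N → ℝ, Continuous g → ∃ b, ∀ t, g (f t) ≤ b := fun g hg => by
    obtain ⟨b, hb⟩ := (isCompact_range (hg.comp hf)).bddAbove
    exact ⟨b, fun t => hb (mem_range_self t)⟩
  obtain ⟨d, hd⟩ := hbdd dirichlet continuous_dirichlet
  choose b hb using fun i => hbdd (hardyInt (s i))
    (continuous_hardyInt (N := N) (hs i).1.le (hs i).2)
  -- Compactness gives a positive minimum of the critical integral, as the uniform statement
  -- requires.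
  obtain ⟨t₀, -, ht₀⟩ := isCompact_univ.exists_isMinOn univ_nonempty
    (continuous_critInt.comp hf).continuousOn
  filter_upwards [eventually_energy_smul_neg (N := N) hs hlam d (critInt (f t₀)) b
    (critInt_pos (h0 t₀))] with R hR t
  exact hR _ (hd t) (fun i => hb i t) (ht₀ (mem_univ t))

/-- If the segments from `V` and from `-V` to `u` both met 0, eliminating `V` would give a
nonnegative multiple of `u` equal to 0, forcing a zero at an endpoint. The energy is even, so the
sign of `V` is free. -/
theorem exists_sign_segment_ne_zero {X : Type*} [AddCommGroup X] [Module ℝ X] {u V : X}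
    (hu : u ≠ 0) (hV : V ≠ 0) :
    ∃ W : X, (W = V ∨ W = -V) ∧ ∀ t : unitInterval, (1 - (t : ℝ)) • W + (t : ℝ) • u ≠ 0 := by
  by_contra! hcon
  obtain ⟨a, ha⟩ := hcon V (Or.inl rfl)
  obtain ⟨b, hb⟩ := hcon (-V) (Or.inr rfl)
  have ha0 := a.2.1
  have ha1 := a.2.2
  have hb0 := b.2.1
  have hb1 := b.2.2
  have key : ((1 - (b : ℝ)) * a + (1 - (a : ℝ)) * b) • u = 0 := by
    have h1 : (1 - (b : ℝ)) • ((1 - (a : ℝ)) • V + (a : ℝ) • u)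
        + (1 - (a : ℝ)) • ((1 - (b : ℝ)) • (-V) + (b : ℝ) • u) = 0 := by
      rw [ha, hb, smul_zero, smul_zero, add_zero]
    rw [← h1]
    module
  have h0 := (smul_eq_zero.1 key).resolve_right hu
  have h1 : 0 ≤ (1 - (b : ℝ)) * a := mul_nonneg (by linarith) ha0
  have h2 : 0 ≤ (1 - (a : ℝ)) * b := mul_nonneg (by linarith) hb0
  have hab : (1 - (b : ℝ)) * a = 0 := by linarith
  have hba : (1 - (a : ℝ)) * b = 0 := by linarith
  rcases eq_or_ne (a : ℝ) 0 with h | h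
  · rw [h, sub_zero, one_smul, zero_smul, add_zero] at ha
    exact hV ha
  · have hb' : (b : ℝ) = 1 := by
      have := (mul_eq_zero.1 hab).resolve_right h
      linarith
    rw [hb', sub_self, zero_smul, one_smul, zero_add] at hb
    exact hu hb

theorem energy_neg_apply (u : D12 N) : energy s lam (-u) = energy s lam u := by
  have h : ∀ᵐ x, |(-u).fn x| = |u.fn x| := by
    filter_upwards [Lp.coeFn_neg u.fn] with x hx
    have : (-u).fn x = -(u.fn x) := hx
    rw [this, abs_neg]
  have h1 : dirichlet (-u) = dirichlet u := by
    rw [← neg_one_smul ℝ u, dirichlet_smul]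
    norm_num
  have h2 : ∀ r, hardyInt r (-u) = hardyInt r u := fun r =>
    integral_congr_ae (h.mono fun x hx => by simp only [hx])
  have h3 : critInt (-u) = critInt u := by rw [← hardyInt_zero, h2, hardyInt_zero]
  simp only [energy, h1, h2, h3]

theorem exists_path_energy_lt (hs : ∀ i, 0 < s i ∧ s i < 2) (hlam : ∀ i, lam i < 0)
    {u₀ : D12 N} (hu₀ : energy s lam u₀ < 0) {c : ℝ} (hc : groundLevel N < c) :
    ∃ γ ∈ pathsTo u₀, ∀ t, energy s lam (γ t) < c := by
  have hc0 : 0 < c := (groundLevel_pos N).trans hc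
  obtain ⟨V, hV, hray⟩ := exists_ray_energy_lt (N := N) hs hlam hc
  obtain ⟨W, hWV, hseg⟩ := exists_sign_segment_ne_zero (ne_zero_of_energy_neg hs hu₀) hV
  have hrayW : ∀ t : ℝ, 0 ≤ t → energy s lam (t • W) < c := by
    intro t ht
    rcases hWV with rfl | rfl
    · exact hray t ht
    · rw [smul_neg, energy_neg_apply]
      exact hray t ht
  set f : unitInterval → D12 N := fun t => (1 - (t : ℝ)) • W + (t : ℝ) • u₀ with hf
  have hfc : Continuous f := by
    have := continuous_subtype_val (p := fun x : ℝ => x ∈ unitInterval)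
    exact ((continuous_const.sub this).smul continuous_const).add (this.smul continuous_const)
  obtain ⟨R, hR, hR1⟩ := ((eventually_segment_energy_neg hs hlam hfc hseg).and
    (eventually_ge_atTop 1)).exists
  -- Three legs inside this sublevel set: out along the ray of `W`, across the dilated segment where
  -- the energy is negative, and back down the ray of `u₀`.
  let F : Set (D12 N) := {u | energy s lam u < c}
  have j1 : JoinedIn F 0 (R • W) := by
    have hcont : Continuous fun t : ℝ => t * R := by fun_prop
    have hcont' : Continuous fun t : ℝ => (t * R) • W := hcont.smul continuous_const
    refine JoinedIn.ofLine hcont'.continuousOn (by simp) (by simp) ?_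
    rintro _ ⟨t, ht, rfl⟩
    exact hrayW _ (mul_nonneg ht.1 (by linarith))
  have j2 : JoinedIn F (R • W) (R • u₀) := by
    refine ⟨⟨⟨fun t => R • f t, hfc.const_smul R⟩, by simp [hf], by simp [hf]⟩,
      fun t => (hR t).trans hc0⟩
  have j3 : JoinedIn F (R • u₀) u₀ := by
    have hcont : Continuous fun t : ℝ => t + (1 - t) * R := by fun_prop
    have hcont' : Continuous fun t : ℝ => (t + (1 - t) * R) • u₀ := hcont.smul continuous_const
    refine JoinedIn.ofLine hcont'.continuousOn (by simp) (by simp) ?_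
    rintro _ ⟨t, ht, rfl⟩
    refine (energy_smul_neg_of_one_le hs hlam hu₀ ?_).trans hc0
    nlinarith [ht.1, ht.2]
  obtain ⟨γ, hγ⟩ := (j1.trans j2).trans j3
  exact ⟨γ, ⟨D12.continuous_grad.comp γ.continuous, γ.source, γ.target⟩, hγ⟩

end Paths

/-! ### Critical points and solutions lie on the Nehari manifold -/

section CriticalPoints

variable {N : ℕ} [Fact (3 ≤ N)] {l : ℕ} {s lam : Fin l → ℝ}

theorem hasDerivAt_energy_ray (hs : ∀ i, 0 < s i ∧ s i < 2) (u : D12 N) :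
    HasDerivAt (fun t : ℝ => energy s lam (u + t • u))
      (dirichlet u - ∑ i, lam i * hardyInt (s i) u - critInt u) 0 := by
  have hp0 := critExp_pos N
  have hpow : ∀ q : ℝ, HasDerivAt (fun t : ℝ => (1 + t) ^ q) q 0 := by
    intro q
    have h := ((hasDerivAt_id (0 : ℝ)).const_add 1).rpow_const (p := q) (Or.inl (by simp))
    simpa using h
  have hsum : HasDerivAt (fun t : ℝ =>
      1 / 2 * ((1 + t) ^ (2 : ℝ) * dirichlet u)
      - ∑ i, lam i / hsExp N (s i) * ((1 + t) ^ hsExp N (s i) * hardyInt (s i) u)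
      - 1 / critExp N * ((1 + t) ^ critExp N * critInt u))
      (1 / 2 * (2 * dirichlet u)
      - ∑ i, lam i / hsExp N (s i) * (hsExp N (s i) * hardyInt (s i) u)
      - 1 / critExp N * (critExp N * critInt u)) 0 :=
    ((((hpow 2).mul_const _).const_mul _).sub
      (HasDerivAt.fun_sum fun i _ => ((hpow _).mul_const _).const_mul _)).sub
      (((hpow _).mul_const _).const_mul _)
  have e : 1 / 2 * (2 * dirichlet u)
      - ∑ i, lam i / hsExp N (s i) * (hsExp N (s i) * hardyInt (s i) u)
      - 1 / critExp N * (critExp N * critInt u) =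
      dirichlet u - ∑ i, lam i * hardyInt (s i) u - critInt u := by
    have h1 : ∀ i, lam i / hsExp N (s i) * (hsExp N (s i) * hardyInt (s i) u) =
        lam i * hardyInt (s i) u := fun i => by
      rw [← mul_assoc, div_mul_cancel₀ _ (hsExp_pos N (hs i).2).ne']
    simp only [h1]
    rw [← mul_assoc, ← mul_assoc, one_div_mul_cancel two_ne_zero, one_div_mul_cancel hp0.ne',
      one_mul, one_mul]
  rw [e] at hsum
  refine hsum.congr_of_eventuallyEq ?_
  -- For `t ≥ -1` the point `u + t • u` is a nonnegative multiple of `u`, where the homogeneity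
  -- formula applies.
  filter_upwards [eventually_ge_nhds (show (-1 : ℝ) < 0 by norm_num)] with t ht
  have h1 : u + t • u = (1 + t) • u := by rw [add_smul, one_smul]
  rw [h1, energy_smul hs (by linarith), Real.rpow_two]

theorem IsCriticalPoint.mem_nehari (hs : ∀ i, 0 < s i ∧ s i < 2) {u : D12 N} (hu : u ≠ 0)
    (h : IsCriticalPoint s lam u) : u ∈ nehari N s lam :=
  ⟨hu, (hasDerivAt_energy_ray hs u).unique (h u)⟩

/-- The nonlinearity lies in the dual weighted space, so the weak equation extends by density from
test functions to `u` itself. -/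
theorem memLp_rpow_sub_one {r : ℝ} (hr0 : 0 ≤ r) (hr2 : r < 2) {u : D12 N}
    (hu : ∀ᵐ x, 0 < u.fn x) :
    MemLp (fun x => u.fn x ^ (hsExp N r - 1)) (hsConjLp N r) (hardyMeasure N r) := by
  have hq : 0 < hsExp N r - 1 := by linarith [two_lt_hsExp N hr2]
  have h := (memLp_fn hr0 hr2 u).norm_rpow_div (ENNReal.ofReal (hsExp N r - 1))
  rw [ENNReal.toReal_ofReal hq.le, hsLp, ← ENNReal.ofReal_div_of_pos hq] at h
  refine (memLp_congr_ae ((hardyMeasure_absolutelyContinuous N r).ae_le ?_)).1 h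
  filter_upwards [hu] with x hx
  rw [Real.norm_eq_abs, abs_of_pos hx]

theorem integral_fn_mul_rpow_sub_one {r : ℝ} {u : D12 N} (hu : ∀ᵐ x, 0 < u.fn x) :
    ∫ x, u.fn x * u.fn x ^ (hsExp N r - 1) ∂(hardyMeasure N r) = hardyInt r u := by
  rw [integral_hardyMeasure]
  refine integral_congr_ae ?_
  filter_upwards [hu] with x hx
  rw [abs_of_pos hx, Real.rpow_sub_one hx.ne', mul_div_cancel₀ _ hx.ne']

theorem integral_ofTest_mul {r : ℝ} {φ : E N → ℝ} (hφ : IsTest φ) (g : E N → ℝ) :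
    ∫ x, (ofTest φ hφ).fn x * g x ∂(hardyMeasure N r) = ∫ x, g x / ‖x‖ ^ r * φ x := by
  rw [integral_hardyMeasure]
  refine integral_congr_ae ?_
  filter_upwards [fn_ofTest hφ] with x hx
  rw [hx]
  ring

/-- Positive weak solutions lie on the Nehari manifold. -/
theorem IsPositiveSolution.mem_nehari (hs : ∀ i, 0 < s i ∧ s i < 2) {u : D12 N}
    (h : IsPositiveSolution s lam u) : u ∈ nehari N s lam := by
  obtain ⟨hpos, hweak⟩ := h
  refine ⟨?_, ?_⟩
  · rintro rfl
    obtain ⟨x, hx, hx0⟩ := (hpos.and (Lp.coeFn_zero ℝ (critLp N)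
      (volume : Measure (E N)))).exists
    rw [D12.fn_zero, hx0] at hx
    exact lt_irrefl _ hx
  -- The critical term is written as the case `s = 0` of the Hardy terms, so that the same duality
  -- covers it.
  · have hcont : Continuous fun v : D12 N => inner ℝ u.grad v.grad
        - ∑ i, lam i * ∫ x, v.fn x * u.fn x ^ (hsExp N (s i) - 1) ∂(hardyMeasure N (s i))
        - ∫ x, v.fn x * u.fn x ^ (hsExp N 0 - 1) ∂(hardyMeasure N 0) := by
      refine ((continuous_const.inner D12.continuous_grad).sub (continuous_finsetSum _ fun i _ =>
        continuous_const.mul ?_)).sub ?_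
      · exact continuous_integral_fn_mul (hs i).1.le (hs i).2
          (memLp_rpow_sub_one (hs i).1.le (hs i).2 hpos)
      · exact continuous_integral_fn_mul le_rfl two_pos (memLp_rpow_sub_one le_rfl two_pos hpos)
    have hzero := D12.induction (isClosed_eq hcont continuous_const) (fun φ hφ => by
      have h1 : inner ℝ u.grad (ofTest φ hφ).grad = ∫ x, inner ℝ (u.grad x) (gradient φ x) := by
        rw [L2.inner_def]
        refine integral_congr_ae ?_
        filter_upwards [grad_ofTest hφ] with x hx
        rw [hx]
      have h2 := hweak φ hφ
      simp only [integral_ofTest_mul, h1]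
      simp only [Real.rpow_zero, div_one, hsExp_zero]
      linarith : ∀ (φ : E N → ℝ) (hφ : IsTest φ), _ = (0 : ℝ)) u
    simp only [integral_fn_mul_rpow_sub_one hpos, hardyInt_zero] at hzero
    rw [real_inner_self_eq_norm_sq, ← dirichlet_eq] at hzero
    exact hzero

end CriticalPoints

/-! ### The three infima -/

section Levels

variable {N : ℕ} [Fact (3 ≤ N)] {l : ℕ} {s lam : Fin l → ℝ}

/-- The strict form of the first hypothesis matches the bounds available here, which also express
non-attainment. -/
theorem isGLB_of_forall_lt_of_exists_lt {A : Set ℝ} {c : ℝ} (h1 : ∀ a ∈ A, c < a)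
    (h2 : ∀ b, c < b → ∃ a ∈ A, a < b) : IsGLB A c := by
  refine ⟨fun a ha => (h1 a ha).le, fun b hb => le_of_not_gt fun hcb => ?_⟩
  obtain ⟨a, ha, hab⟩ := h2 b hcb
  exact (hb ha).not_gt hab

theorem isGLB_pathMaxima (hl : 0 < l) (hs : ∀ i, 0 < s i ∧ s i < 2) (hlam : ∀ i, lam i < 0)
    {u₀ : D12 N} (hu₀ : energy s lam u₀ < 0) :
    IsGLB (pathMaxima s lam u₀) (groundLevel N) := by
  refine isGLB_of_forall_lt_of_exists_lt ?_ fun b hb => ?_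
  · rintro m ⟨γ, hγ, hm⟩
    obtain ⟨t, ht⟩ := exists_groundLevel_lt_energy_path hl hs hlam hu₀ hγ
    exact ht.trans_le (hm.2 (mem_range_self t))
  · obtain ⟨γ, hγ, hlt⟩ := exists_path_energy_lt hs hlam hu₀ hb
    have hc : Continuous fun t => energy s lam (γ t) :=
      (continuous_energy hs).comp (continuous_of_continuous_grad hγ.1)
    obtain ⟨m, hm⟩ := (isCompact_range hc).exists_isGreatest (range_nonempty _)
    obtain ⟨t, rfl⟩ := hm.1
    exact ⟨_, ⟨γ, hγ, hm⟩, hlt t⟩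

theorem isGLB_energy_nehari (hl : 0 < l) (hs : ∀ i, 0 < s i ∧ s i < 2)
    (hlam : ∀ i, lam i < 0) :
    IsGLB (energy s lam '' nehari N s lam) (groundLevel N) := by
  refine isGLB_of_forall_lt_of_exists_lt ?_ fun b hb => ?_
  · rintro _ ⟨u, hu, rfl⟩
    exact groundLevel_lt_energy_of_mem_nehari hl hs hlam hu
  · obtain ⟨V, hV, hlt⟩ := exists_ray_energy_lt (N := N) hs hlam hb
    obtain ⟨t, ht, hmem⟩ := exists_smul_mem_nehari hs hlam hV
    exact ⟨_, ⟨_, hmem, rfl⟩, hlt t ht.le⟩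

theorem isGLB_rayMaxima (hl : 0 < l) (hs : ∀ i, 0 < s i ∧ s i < 2) (hlam : ∀ i, lam i < 0) :
    IsGLB (rayMaxima N s lam) (groundLevel N) := by
  refine isGLB_of_forall_lt_of_exists_lt ?_ fun b hb => ?_
  · rintro m ⟨V, hV, hm⟩
    obtain ⟨t, ht, hlt⟩ := exists_groundLevel_lt_energy_smul hl hs hlam hV
    exact hlt.trans_le (hm.2 ⟨t, ht, rfl⟩)
  · obtain ⟨V, hV, hlt⟩ := exists_ray_energy_lt (N := N) hs hlam hb
    obtain ⟨t, ht, hmem⟩ := exists_smul_mem_nehari hs hlam hV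
    -- The Nehari point on the ray realises its maximum, so the maximum exists.
    refine ⟨_, ⟨V, hV, ⟨t, ht.le, rfl⟩, ?_⟩, hlt t ht.le⟩
    rintro _ ⟨r, hr, rfl⟩
    have h := energy_smul_le_of_mem_nehari hs hlam hmem (div_nonneg hr ht.le)
    rwa [smul_smul, div_mul_cancel₀ _ ht.ne'] at h

theorem mountainPassLevel_eq (hl : 0 < l) (hs : ∀ i, 0 < s i ∧ s i < 2)
    (hlam : ∀ i, lam i < 0) {u₀ : D12 N} (hu₀ : energy s lam u₀ < 0) :
    mountainPassLevel s lam u₀ = groundLevel N := by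
  have h := isGLB_pathMaxima hl hs hlam hu₀
  -- A set of reals with a greatest lower bound is nonempty, so `sInf` is not a default value.
  exact h.csInf_eq h.nonempty

end Levels

end HardySobolev

end

theorem mainTheorem5 (N : ℕ) [Fact (3 ≤ N)] (l : ℕ) (hl : 0 < l) (s lam : Fin l → ℝ)
    (hs_mono : StrictMono s) (hs : ∀ i, 0 < s i ∧ s i < 2) (hlam : ∀ i, lam i < 0) :
    (∃ u₀ : HardySobolev.D12 N, HardySobolev.energy s lam u₀ < 0) ∧
    (∀ u₀ : HardySobolev.D12 N, HardySobolev.energy s lam u₀ < 0 →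
      -- the mountain-pass level is a genuine infimum, with the stated value
      IsGLB (HardySobolev.pathMaxima s lam u₀) (HardySobolev.mountainPassLevel s lam u₀) ∧
      HardySobolev.mountainPassLevel s lam u₀
        = HardySobolev.sobolevConst N ^ ((N : ℝ) / 2) / N ∧
      -- it is also the infimum over rays and over the Nehari manifold
      IsGLB (HardySobolev.rayMaxima N s lam) (HardySobolev.mountainPassLevel s lam u₀) ∧
      IsGLB (HardySobolev.energy s lam '' HardySobolev.nehari N s lam)
        (HardySobolev.mountainPassLevel s lam u₀) ∧
      -- it is attained neither along a path, nor along a ray, nor at a critical point or solution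
      (∀ γ ∈ HardySobolev.pathsTo u₀, ∃ t : unitInterval,
        HardySobolev.mountainPassLevel s lam u₀ < HardySobolev.energy s lam (γ t)) ∧
      (∀ V : HardySobolev.D12 N, V ≠ 0 → ∃ t : ℝ, 0 ≤ t ∧
        HardySobolev.mountainPassLevel s lam u₀ < HardySobolev.energy s lam (t • V)) ∧
      (¬ ∃ V : HardySobolev.D12 N, HardySobolev.IsCriticalPoint s lam V ∧
        HardySobolev.energy s lam V = HardySobolev.mountainPassLevel s lam u₀) ∧
      (¬ ∃ u : HardySobolev.D12 N, HardySobolev.IsPositiveSolution s lam u ∧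
        HardySobolev.energy s lam u = HardySobolev.mountainPassLevel s lam u₀)) ∧
    (¬ ∃ u : HardySobolev.D12 N, HardySobolev.IsLeastEnergySolution s lam u) := by
  refine ⟨HardySobolev.exists_energy_neg hs hlam, fun u₀ hu₀ => ?_, ?_⟩
  · rw [HardySobolev.mountainPassLevel_eq hl hs hlam hu₀]
    refine ⟨HardySobolev.isGLB_pathMaxima hl hs hlam hu₀, rfl,
      HardySobolev.isGLB_rayMaxima hl hs hlam, HardySobolev.isGLB_energy_nehari hl hs hlam,
      fun γ hγ => HardySobolev.exists_groundLevel_lt_energy_path hl hs hlam hu₀ hγ,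
      fun V hV => HardySobolev.exists_groundLevel_lt_energy_smul hl hs hlam hV, ?_, ?_⟩
    · rintro ⟨V, hV, hVe⟩
      -- The origin is off the Nehari manifold and must be excluded separately: its energy is 0,
      -- while the level is positive.
      have hV0 : V ≠ 0 := by
        rintro rfl
        rw [HardySobolev.energy_zero hs] at hVe
        exact (HardySobolev.groundLevel_pos N).ne hVe
      exact (HardySobolev.groundLevel_lt_energy_of_mem_nehari hl hs hlam
        (hV.mem_nehari hs hV0)).ne' hVe
    · rintro ⟨u, hu, hue⟩
      exact (HardySobolev.groundLevel_lt_energy_of_mem_nehari hl hs hlam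
        (hu.mem_nehari hs)).ne' hue
  · rintro ⟨u, hu, hmin⟩
    have h1 := HardySobolev.groundLevel_lt_energy_of_mem_nehari hl hs hlam (hu.mem_nehari hs)
    -- Minimality would make the energy of `u` a lower bound on the Nehari manifold, hence at most
    -- the level, although `u` lies strictly above it.
    refine h1.not_ge ((HardySobolev.isGLB_energy_nehari hl hs hlam).2 ?_)
    rintro _ ⟨v, hv, rfl⟩
    exact hmin v hv
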